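/- Proposition 1.12. Let $n\in\mathbb N$. Write $\langle\xi\rangle=(1+|\xi|^2)^{1/2}$ and $\mathcal F f(\xi)=(2\pi)^{-n/2}\int_{\mathbb R^n} f(x)e^{-ix\cdot\xi}\,dx$, extended to the space $\mathcal S'(\mathbb R^n)$ of tempered distributions. Let $\phi\in\mathcal S(\mathbb R^n)\setminus\{0\}$ be a window and, for $f\in\mathcal S'(\mathbb R^n)$, let $$V_\phi f(x,\xi)=(2\pi)^{-n/2}\int_{\mathbb R^n} f(t)\,\overline{\phi(t-x)}\,e^{-it\cdot\xi}\,dt\qquad(x,\xi\in\mathbb R^n),$$ where the integral denotes the pairing of $f$ with the Schwartz function $t\mapsto\overline{\phi(t-x)}e^{-it\cdot\xi}$. Let $\rho\in\mathcal S(\mathbb R^n)$ have values in $[0,1]$, be supported in the cube $[-1,1]^n$ and satisfy $\rho(\xi)=1$ for $|\xi|\le\frac12$ and $\sum_{k\in\mathbb Z^n}\rho(\xi-k)>0$ for every $\xi\in\mathbb R^n$. Put $$\sigma_k(\xi)=\rho(\xi-k)\Big(\sum_{l\in\mathbb Z^n}\rho(\xi-l)\Big)^{-1},\qquad \Box_k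 f=\mathcal F^{-1}(\sigma_k\,\mathcal F f)\qquad(k\in\mathbb Z^n).$$ For $s\in\mathbb R$, $p,q\in[1,\infty]$ and $f\in\mathcal S'(\mathbb R^n)$ define, with values in $[0,\infty]$, $$\|f\|_{\mathring M^{p,q}_s}=\Big(\int_{\mathbb R^n}\Big(\int_{\mathbb R^n}|V_\phi f(x,\xi)\langle\xi\rangle^s|^p\,dx\Big)^{q/p}d\xi\Big)^{1/q},\qquad \|f\|_{M^{p,q}_s}=\Big(\sum_{k\in\mathbb Z^n}\langle k\rangle^{sq}\,\|\Box_k f\|_{L^p}^q\Big)^{1/q},$$ with the usual modifications if $p=\infty$ or $q=\infty$; here $\|\Box_kf\|_{L^p}=\infty$ if the distribution $\Box_kf$ is not given by an $L^p$ function. Then for every $s\in\mathbb R$ there are constants $C_1,C_2>0$, depending only on $n$, $s$, the window $\phi$ and the decomposition function $\rho$, such that for all $p,q\in[1,\infty]$ and all $f\in\mathcal S'(\mathbb R^n)$ $$C_1\,\|f\|_{\mathring M^{p,q}_s}\le\|f\|_{M^{p,q}_s}\le C_2\,\|f\|_{\mathring M^{p,q}_s}.$$ In particular, one of the two norms is finite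 if and only if the other one is. -/

import Mathlib

open MeasureTheory
open scoped SchwartzMap FourierTransform ENNReal NNReal ComplexConjugate

noncomputable section

namespace ModulationSpace

/-- The Japanese bracket power `⟨ξ⟩ ^ s = (1 + |ξ|²) ^ (s / 2)`, with the Euclidean norm. -/
def bracket {n : ℕ} (s : ℝ) (ξ : EuclideanSpace ℝ (Fin n)) : ℝ :=
  (1 + ‖ξ‖ ^ 2) ^ (s / 2)

/-- The lattice point `k ∈ ℤⁿ`, as a vector of `ℝⁿ`. -/
def latticePoint {n : ℕ} (k : Fin n → ℤ) : EuclideanSpace ℝ (Fin n) :=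
  WithLp.toLp 2 (fun i => (k i : ℝ))

/-! ### The Fourier transform in the normalization `(2π)^{-n/2} ∫ f(x) e^{-i x·ξ} dx` -/

/-- The dilation `x ↦ (2π)⁻¹ x` of `ℝⁿ`. -/
def dilation (n : ℕ) : EuclideanSpace ℝ (Fin n) ≃L[ℝ] EuclideanSpace ℝ (Fin n) :=
  ContinuousLinearEquiv.smulLeft (Units.mk0 ((2 * Real.pi)⁻¹ : ℝ) (by positivity))

/-- The normalizing factor `(2π)^{-n/2}`. -/
def normFactor (n : ℕ) : ℂ := (((2 * Real.pi) ^ (-(n : ℝ) / 2) : ℝ) : ℂ)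

/-- `𝓕 u (ξ) = (2π)^{-n/2} ∫ u(x) e^{-i x·ξ} dx` on Schwartz functions. Mathlib's transform
uses the kernel `e^{-2π i x·ξ}` and no factor, hence the dilation; see `fourierS_apply`. -/
def fourierS (n : ℕ) :
    𝓢(EuclideanSpace ℝ (Fin n), ℂ) →L[ℂ] 𝓢(EuclideanSpace ℝ (Fin n), ℂ) :=
  normFactor n • (SchwartzMap.compCLMOfContinuousLinearEquiv ℂ (dilation n)).comp
    (FourierTransform.fourierCLM ℂ 𝓢(EuclideanSpace ℝ (Fin n), ℂ))

/-- `𝓕⁻¹ u (x) = (2π)^{-n/2} ∫ u(ξ) e^{i x·ξ} dξ` on Schwartz functions;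
see `fourierInvS_apply`. -/
def fourierInvS (n : ℕ) :
    𝓢(EuclideanSpace ℝ (Fin n), ℂ) →L[ℂ] 𝓢(EuclideanSpace ℝ (Fin n), ℂ) :=
  normFactor n • (SchwartzMap.compCLMOfContinuousLinearEquiv ℂ (dilation n)).comp
    (FourierTransform.fourierInvCLM ℂ 𝓢(EuclideanSpace ℝ (Fin n), ℂ))

theorem fourierS_apply {n : ℕ} (u : 𝓢(EuclideanSpace ℝ (Fin n), ℂ))
    (ξ : EuclideanSpace ℝ (Fin n)) :
    fourierS n u ξ = normFactor n * ∫ x, u x * Complex.exp (-Complex.I * (inner ℝ x ξ : ℝ)) := by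
  have h : fourierS n u ξ = normFactor n * (𝓕 u) ((2 * Real.pi)⁻¹ • ξ) := rfl
  rw [h, SchwartzMap.fourier_coe, Real.fourier_eq']
  congr 2
  ext x
  rw [smul_eq_mul, mul_comm, real_inner_smul_right]
  congr 2
  have : (Real.pi : ℂ) ≠ 0 := by exact_mod_cast Real.pi_ne_zero
  push_cast
  field_simp

theorem fourierInvS_apply {n : ℕ} (u : 𝓢(EuclideanSpace ℝ (Fin n), ℂ))
    (x : EuclideanSpace ℝ (Fin n)) :
    fourierInvS n u x = normFactor n * ∫ ξ, u ξ * Complex.exp (Complex.I * (inner ℝ x ξ : ℝ)) := by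
  have h : fourierInvS n u x = normFactor n * (𝓕⁻ u) ((2 * Real.pi)⁻¹ • x) := rfl
  rw [h, SchwartzMap.fourierInv_coe, Real.fourierInv_eq']
  congr 2
  ext ξ
  rw [smul_eq_mul, mul_comm, real_inner_smul_right, real_inner_comm]
  congr 2
  have : (Real.pi : ℂ) ≠ 0 := by exact_mod_cast Real.pi_ne_zero
  push_cast
  field_simp

/-- The Fourier transform of a tempered distribution: `(𝓕 f)(u) = f(𝓕 u)`. -/
def fourierD (n : ℕ) :
    𝓢'(EuclideanSpace ℝ (Fin n), ℂ) →L[ℂ] 𝓢'(EuclideanSpace ℝ (Fin n), ℂ) :=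
  PointwiseConvergenceCLM.precomp ℂ (fourierS n)

/-- The inverse Fourier transform of a tempered distribution: `(𝓕⁻¹ f)(u) = f(𝓕⁻¹ u)`. -/
def fourierInvD (n : ℕ) :
    𝓢'(EuclideanSpace ℝ (Fin n), ℂ) →L[ℂ] 𝓢'(EuclideanSpace ℝ (Fin n), ℂ) :=
  PointwiseConvergenceCLM.precomp ℂ (fourierInvS n)

/-! ### The short-time Fourier transform and its modulation norm -/

/-- The character `t ↦ e^{-i t·ξ}` on `ℝⁿ`. -/
def character {n : ℕ} (ξ : EuclideanSpace ℝ (Fin n)) (t : EuclideanSpace ℝ (Fin n)) : ℂ :=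
  Complex.exp (-Complex.I * (inner ℝ t ξ : ℝ))

theorem character_hasTemperateGrowth {n : ℕ} (ξ : EuclideanSpace ℝ (Fin n)) :
    (character ξ).HasTemperateGrowth := by
  have hd : ∀ m : ℕ, iteratedDeriv m (fun t : ℝ => Complex.exp (-Complex.I * (t : ℂ))) =
      fun t : ℝ => (-Complex.I) ^ m * Complex.exp (-Complex.I * (t : ℂ)) := by
    intro m
    induction m with
    | zero => simp
    | succ m ih =>
      rw [iteratedDeriv_succ, ih]
      ext t
      have h : HasDerivAt (fun t : ℝ => -Complex.I * (t : ℂ)) (-Complex.I) t := by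
        simpa using (Complex.ofRealCLM.hasDerivAt (x := t)).const_mul (-Complex.I)
      rw [(h.cexp.const_mul ((-Complex.I) ^ m)).deriv]
      ring
  have he : (fun t : ℝ => Complex.exp (-Complex.I * (t : ℂ))).HasTemperateGrowth := by
    refine ⟨(contDiff_const.mul Complex.ofRealCLM.contDiff).cexp, fun m => ⟨0, 1, fun t => ?_⟩⟩
    rw [norm_iteratedFDeriv_eq_norm_iteratedDeriv, hd m]
    have : ‖Complex.exp (-Complex.I * (t : ℂ))‖ = 1 := by
      rw [Complex.norm_exp]
      simp
    simpa using this.le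
  exact he.comp (Function.hasTemperateGrowth_inner_left ξ)

/-- The Schwartz function `t ↦ conj (φ (t - x)) e^{-i t·ξ}`, the complex conjugate of the
time-frequency shift `M_ξ T_x φ`; see `timeFreqShift_apply`. -/
def timeFreqShift {n : ℕ} (φ : 𝓢(EuclideanSpace ℝ (Fin n), ℂ))
    (x ξ : EuclideanSpace ℝ (Fin n)) : 𝓢(EuclideanSpace ℝ (Fin n), ℂ) :=
  SchwartzMap.smulLeftCLM ℂ (character ξ)
    (SchwartzMap.compSubConstCLM ℝ x
      (SchwartzMap.postcompCLM (𝕜 := ℝ) (Complex.conjCLE : ℂ →L[ℝ] ℂ) φ))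

theorem timeFreqShift_apply {n : ℕ} (φ : 𝓢(EuclideanSpace ℝ (Fin n), ℂ))
    (x ξ t : EuclideanSpace ℝ (Fin n)) :
    timeFreqShift φ x ξ t = conj (φ (t - x)) * Complex.exp (-Complex.I * (inner ℝ t ξ : ℝ)) := by
  rw [timeFreqShift, SchwartzMap.smulLeftCLM_apply_apply (character_hasTemperateGrowth ξ),
    smul_eq_mul, mul_comm]
  rfl

/-- The short-time Fourier transform of a tempered distribution `f` with window `φ`,
`V_φ f (x, ξ) = (2π)^{-n/2} ∫ f(t) conj (φ(t - x)) e^{-i t·ξ} dt`, the integral being the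
pairing of `f` with a Schwartz function. -/
def stft {n : ℕ} (φ : 𝓢(EuclideanSpace ℝ (Fin n), ℂ)) (f : 𝓢'(EuclideanSpace ℝ (Fin n), ℂ))
    (x ξ : EuclideanSpace ℝ (Fin n)) : ℂ :=
  normFactor n * f (timeFreqShift φ x ξ)

/-- The norm `‖f‖ = ( ∫ ( ∫ |V_φ f(x,ξ) ⟨ξ⟩^s|^p dx )^{q/p} dξ )^{1/q}`, with `L^∞` norms when
`p = ∞` or `q = ∞`; it has the value `∞` exactly if `f` is not in the space. -/
def stftNorm {n : ℕ} (φ : 𝓢(EuclideanSpace ℝ (Fin n), ℂ)) (s : ℝ) (p q : ℝ≥0∞)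
    (f : 𝓢'(EuclideanSpace ℝ (Fin n), ℂ)) : ℝ≥0∞ :=
  eLpNorm (fun ξ : EuclideanSpace ℝ (Fin n) =>
    eLpNorm (fun x : EuclideanSpace ℝ (Fin n) => stft φ f x ξ * (bracket s ξ : ℂ)) p volume)
    q volume

/-! ### The frequency-uniform decomposition and its modulation norm -/

/-- The functions `ρ` from which a frequency-uniform decomposition is built: Schwartz functions
with values in `[0,1]`, supported in the cube `[-1,1]ⁿ`, equal to `1` on the ball `|ξ| ≤ 1/2`,
whose integer translates have no common zero. -/
structure IsDecompositionFunction {n : ℕ} (ρ : 𝓢(EuclideanSpace ℝ (Fin n), ℝ)) : Prop where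
  nonneg : ∀ ξ, 0 ≤ ρ ξ
  le_one : ∀ ξ, ρ ξ ≤ 1
  support_subset : ∀ ξ, ρ ξ ≠ 0 → ∀ i, -1 ≤ ξ i ∧ ξ i ≤ 1
  eq_one : ∀ ξ, ‖ξ‖ ≤ 1 / 2 → ρ ξ = 1
  cover : ∀ ξ, ∃ k : Fin n → ℤ, ρ (ξ - latticePoint k) ≠ 0

/-- `σ_k(ξ) = ρ(ξ - k) / ∑_{l ∈ ℤⁿ} ρ(ξ - l)`; at each `ξ` the sum has finitely many nonzero
terms. -/
def sigma {n : ℕ} (ρ : 𝓢(EuclideanSpace ℝ (Fin n), ℝ)) (k : Fin n → ℤ)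
    (ξ : EuclideanSpace ℝ (Fin n)) : ℝ :=
  ρ (ξ - latticePoint k) * (∑' l : Fin n → ℤ, ρ (ξ - latticePoint l))⁻¹

theorem sigma_hasTemperateGrowth {n : ℕ} {ρ : 𝓢(EuclideanSpace ℝ (Fin n), ℝ)}
    (hρ : IsDecompositionFunction ρ) (k : Fin n → ℤ) :
    (fun ξ => (sigma ρ k ξ : ℂ)).HasTemperateGrowth := by
  have hbd : ∀ (l : Fin n → ℤ) (ξ : EuclideanSpace ℝ (Fin n)), ρ (ξ - latticePoint l) ≠ 0 →
      ∀ i, |ξ i - l i| ≤ 1 := fun l ξ h i => abs_le.2 (by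
    simpa [latticePoint] using hρ.support_subset _ h i)
  have hfin : ∀ R : ℝ, {l : Fin n → ℤ | ∀ i, |(l i : ℝ)| ≤ R}.Finite := fun R => by
    refine (Set.Finite.pi' (fun _ : Fin n => Set.finite_Icc (-⌈R⌉) ⌈R⌉)).subset fun l hl i => ?_
    have := abs_le.1 (hl i)
    have h2 := Int.le_ceil R
    constructor
    · exact_mod_cast (by push_cast; linarith : ((-⌈R⌉ : ℤ) : ℝ) ≤ l i)
    · exact_mod_cast (by linarith : (l i : ℝ) ≤ ⌈R⌉)
  have hcoord : ∀ (ξ : EuclideanSpace ℝ (Fin n)) (i : Fin n), |ξ i| ≤ ‖ξ‖ := fun ξ i => by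
    simpa using PiLp.norm_apply_le ξ i
  have hlf : LocallyFinite fun l : Fin n → ℤ =>
      Function.support fun ξ : EuclideanSpace ℝ (Fin n) => ρ (ξ - latticePoint l) := by
    intro ξ
    refine ⟨Metric.ball ξ 1, Metric.ball_mem_nhds ξ one_pos,
      (hfin (‖ξ‖ + 2)).subset ?_⟩
    rintro l ⟨η, hη, hηξ⟩ i
    have h1 := hbd l η hη i
    have h2 := hcoord η i
    have h3 : ‖η‖ ≤ ‖ξ‖ + 1 := by
      have := norm_le_norm_add_norm_sub' η ξ
      have h4 : ‖η - ξ‖ < 1 := by simpa [dist_eq_norm] using hηξ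
      linarith
    have h5 : |(l i : ℝ)| ≤ |η i| + |η i - l i| := by
      have := abs_sub (η i) (η i - l i)
      simpa using this
    linarith
  have hsm : ∀ l : Fin n → ℤ,
      ContDiff ℝ (⊤ : ℕ∞) fun ξ : EuclideanSpace ℝ (Fin n) => ρ (ξ - latticePoint l) :=
    fun l => (ρ.smooth _).comp (contDiff_id.sub contDiff_const)
  have hsum : ∀ ξ, ∑' l : Fin n → ℤ, ρ (ξ - latticePoint l) =
      ∑ᶠ l : Fin n → ℤ, ρ (ξ - latticePoint l) := fun ξ =>
    tsum_eq_finsum (hlf.point_finite ξ)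
  have hden : ContDiff ℝ (⊤ : ℕ∞) fun ξ : EuclideanSpace ℝ (Fin n) =>
      ∑' l : Fin n → ℤ, ρ (ξ - latticePoint l) := by
    simp_rw [hsum]
    exact contMDiff_iff_contDiff.1 (contMDiff_finsum (fun l => (hsm l).contMDiff) hlf)
  have hpos : ∀ ξ, ∑' l : Fin n → ℤ, ρ (ξ - latticePoint l) ≠ 0 := fun ξ => by
    obtain ⟨m, hm⟩ := hρ.cover ξ
    have hs : Summable fun l : Fin n → ℤ => ρ (ξ - latticePoint l) :=
      summable_of_hasFiniteSupport (hlf.point_finite ξ)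
    exact (hs.tsum_pos (fun l => hρ.nonneg _) m ((hρ.nonneg _).lt_of_ne' hm)).ne'
  refine HasCompactSupport.hasTemperateGrowth ?_ ?_
  · refine HasCompactSupport.intro (isCompact_closedBall (0 : EuclideanSpace ℝ (Fin n))
      (‖latticePoint k‖ + √n)) fun ξ hξ => ?_
    by_contra h
    have h0 : ρ (ξ - latticePoint k) ≠ 0 := by
      intro h0
      simp [sigma, h0] at h
    have h1 : ‖ξ - latticePoint k‖ ≤ √n := by
      rw [EuclideanSpace.norm_eq]
      refine Real.sqrt_le_sqrt ?_
      calc ∑ i, ‖(ξ - latticePoint k) i‖ ^ 2 ≤ ∑ _i : Fin n, (1 : ℝ) :=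
            Finset.sum_le_sum fun i _ => by
              have := abs_le.2 (hρ.support_subset _ h0 i)
              rw [Real.norm_eq_abs]
              exact pow_le_one₀ (abs_nonneg _) this
        _ = n := by simp
    have h2 := norm_le_norm_add_norm_sub' ξ (latticePoint k)
    exact hξ (by simpa using h2.trans (by linarith))
  · exact Complex.ofRealCLM.contDiff.comp ((hsm k).mul (hden.inv hpos))

/-- The uniform decomposition operator `□_k f = 𝓕⁻¹ (σ_k 𝓕 f)` on tempered distributions. -/
def box {n : ℕ} (ρ : 𝓢(EuclideanSpace ℝ (Fin n), ℝ)) (k : Fin n → ℤ)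
    (f : 𝓢'(EuclideanSpace ℝ (Fin n), ℂ)) : 𝓢'(EuclideanSpace ℝ (Fin n), ℂ) :=
  fourierInvD n (TemperedDistribution.smulLeftCLM ℂ (fun ξ => (sigma ρ k ξ : ℂ)) (fourierD n f))

/-- The function `g` represents the tempered distribution `T`. -/
def Represents {n : ℕ} (g : EuclideanSpace ℝ (Fin n) → ℂ)
    (T : 𝓢'(EuclideanSpace ℝ (Fin n), ℂ)) : Prop :=
  ∀ u : 𝓢(EuclideanSpace ℝ (Fin n), ℂ), T u = ∫ x, g x * u x

/-- The `L^p` norm of a tempered distribution: the `L^p` norm of the `L^p` function that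
represents it (unique up to null sets), and `∞` if there is none. -/
def lpNorm {n : ℕ} (p : ℝ≥0∞) (T : 𝓢'(EuclideanSpace ℝ (Fin n), ℂ)) : ℝ≥0∞ :=
  ⨅ (g : EuclideanSpace ℝ (Fin n) → ℂ) (_ : MemLp g p volume) (_ : Represents g T),
    eLpNorm g p volume

/-- The norm `‖f‖ = ( ∑_{k ∈ ℤⁿ} ⟨k⟩^{sq} ‖□_k f‖_{L^p}^q )^{1/q}`, with a supremum when
`q = ∞`; it has the value `∞` exactly if `f` is not in the space. -/
def decompositionNorm {n : ℕ} (ρ : 𝓢(EuclideanSpace ℝ (Fin n), ℝ)) (s : ℝ) (p q : ℝ≥0∞)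
    (f : 𝓢'(EuclideanSpace ℝ (Fin n), ℂ)) : ℝ≥0∞ :=
  if q = ∞ then
    ⨆ k : Fin n → ℤ, ENNReal.ofReal (bracket s (latticePoint k)) * lpNorm p (box ρ k f)
  else
    (∑' k : Fin n → ℤ,
      (ENNReal.ofReal (bracket s (latticePoint k)) * lpNorm p (box ρ k f)) ^ q.toReal)
        ^ (1 / q.toReal)

end ModulationSpace

end

/-!
Put `U = 𝓕 f` and, for a frequency window `d`, consider the coefficients `U(e^{i t·} d(· - ξ))`.
Up to a unimodular factor and powers of `2π`, the short-time Fourier transform of `f` consists of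
them for `d = conj (𝓕 φ)` and all `ξ`, and the functions `□_k f` consist of them for `d = σ₀` and
`ξ = k ∈ ℤⁿ`. Hence both norms are the same mixed norm, with Lebesgue measure or with counting
measure on `ℤⁿ` in the frequency variable.

To compare the coefficients for two windows `a` and `d`, choose `b` such that the translates
of `b * d`, integrated against the measure `μ` belonging to `d`, resolve the identity. Inserting
this into the coefficients for `a` and writing `a(· - ξ) * b(· - η)` as a Fourier integral expresses
them through those for `d`: by convolution in the position and by a kernel in the frequency. The
Fourier transform of `a(· - ξ) * b(· - η)` decays rapidly, also in `ξ - η`. This absorbs the weights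
by Peetre's inequality, and Minkowski's inequality in the position and Schur's test in the frequency
give the estimate for all `p` and `q` with the same constant.
-/

noncomputable section

namespace ModulationSpace

/-! ### Integrals of families of Schwartz functions -/

theorem exists_strongDual_apply_eq {𝕜 V N : Type*} [RCLike 𝕜] [AddCommGroup V] [Module 𝕜 V]
    [SeminormedAddCommGroup N] [NormedSpace 𝕜 N] (A : V →ₗ[𝕜] N) (U : V →ₗ[𝕜] 𝕜) {C : ℝ}
    (hU : ∀ u, ‖U u‖ ≤ C * ‖A u‖) : ∃ Λ : StrongDual 𝕜 N, ∀ u, U u = Λ (A u) := by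
  obtain ⟨σ, hσ⟩ := A.rangeRestrict.exists_rightInverse_of_surjective A.range_rangeRestrict
  have hAσ : ∀ y, A (σ y) = y := fun y => congrArg Subtype.val (LinearMap.congr_fun hσ y)
  obtain ⟨Λ, hΛ, -⟩ := exists_extension_norm_eq _
    ((U ∘ₗ σ).mkContinuous C fun y => by simpa [hAσ] using hU (σ y))
  refine ⟨Λ, fun u => ?_⟩
  have hker : ‖U (u - σ (A.rangeRestrict u))‖ ≤ 0 := by
    simpa [hAσ] using hU (u - σ (A.rangeRestrict u))
  rw [norm_le_zero_iff, map_sub, sub_eq_zero] at hker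
  exact hker.trans (hΛ (A.rangeRestrict u)).symm

section Exchange

variable {𝕜 E F : Type*} [RCLike 𝕜] [NormedAddCommGroup E] [NormedSpace ℝ E]
  [NormedAddCommGroup F] [NormedSpace ℝ F] [NormedSpace 𝕜 F] [SMulCommClass ℝ 𝕜 F]

theorem norm_pow_smul_iteratedFDeriv_le {s : Finset (ℕ × ℕ)} {m : ℕ × ℕ} (hm : m ∈ s)
    (u : 𝓢(E, F)) (x : E) :
    ‖‖x‖ ^ m.1 • iteratedFDeriv ℝ m.2 u x‖ ≤ s.sup (schwartzSeminormFamily 𝕜 E F) u :=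
  calc ‖‖x‖ ^ m.1 • iteratedFDeriv ℝ m.2 u x‖
      ≤ SchwartzMap.seminorm 𝕜 m.1 m.2 u := by
        simpa [norm_smul] using SchwartzMap.le_seminorm 𝕜 m.1 m.2 u x
    _ ≤ s.sup (schwartzSeminormFamily 𝕜 E F) u :=
        Seminorm.le_finset_sup_apply (p := schwartzSeminormFamily 𝕜 E F) hm

variable (𝕜) in
/-- The family of the weighted derivatives `‖x‖ ^ k • D ^ l u (x)`, indexed by `(k, l) ∈ s` and
`x`, as an element of a Banach space. It turns pairings with a tempered distribution into values
of a bounded functional, so that Bochner integration applies to them. -/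
def weightedDerivs (s : Finset (ℕ × ℕ)) :
    𝓢(E, F) →L[𝕜] lp (fun i : s × E => E [×i.1.1.2]→L[ℝ] F) ∞ :=
  SchwartzMap.mkCLMtoNormedSpace (σ := RingHom.id 𝕜)
    (fun u => ⟨fun i => ‖i.2‖ ^ i.1.1.1 • iteratedFDeriv ℝ i.1.1.2 u i.2, by
      refine memℓp_infty ⟨s.sup (schwartzSeminormFamily 𝕜 E F) u, ?_⟩
      rintro _ ⟨⟨m, x⟩, rfl⟩
      exact norm_pow_smul_iteratedFDeriv_le m.2 u x⟩)
    (fun u v => by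
      ext1
      funext i
      simp only [lp.coeFn_add, Pi.add_apply, ← smul_add]
      congr 1
      exact iteratedFDeriv_add_apply (u.smooth _).contDiffAt (v.smooth _).contDiffAt)
    (fun a u => by
      ext1
      funext i
      simp only [lp.coeFn_smul, Pi.smul_apply, RingHom.id_apply]
      rw [smul_comm]
      congr 1
      exact iteratedFDeriv_const_smul_apply (u.smooth _).contDiffAt)
    ⟨s, 1, zero_le_one, fun u => by
      refine lp.norm_le_of_forall_le (mul_nonneg zero_le_one (apply_nonneg _ _)) ?_
      rintro ⟨m, x⟩
      rw [one_mul]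
      exact norm_pow_smul_iteratedFDeriv_le m.2 u x⟩

theorem weightedDerivs_apply (s : Finset (ℕ × ℕ)) (u : 𝓢(E, F)) (i : s × E) :
    weightedDerivs 𝕜 s u i = ‖i.2‖ ^ i.1.1.1 • iteratedFDeriv ℝ i.1.1.2 u i.2 := rfl

theorem norm_weightedDerivs (s : Finset (ℕ × ℕ)) (u : 𝓢(E, F)) :
    ‖weightedDerivs 𝕜 s u‖ = s.sup (schwartzSeminormFamily 𝕜 E F) u := by
  refine le_antisymm (lp.norm_le_of_forall_le (apply_nonneg _ _) ?_)
    (Seminorm.finset_sup_apply_le (norm_nonneg _) fun m hm => ?_)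
  · rintro ⟨m, x⟩
    exact norm_pow_smul_iteratedFDeriv_le m.2 u x
  · refine SchwartzMap.seminorm_le_bound 𝕜 _ _ _ (norm_nonneg _) fun x => ?_
    have := lp.norm_apply_le_norm ENNReal.top_ne_zero (weightedDerivs 𝕜 s u) (⟨m, hm⟩, x)
    simpa [weightedDerivs_apply, norm_smul] using this

theorem exists_strongDual_weightedDerivs (U : 𝓢(E, F) →L[𝕜] 𝕜) :
    ∃ (s : Finset (ℕ × ℕ)) (Λ : StrongDual 𝕜 (lp (fun i : s × E => E [×i.1.1.2]→L[ℝ] F) ∞)),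
      ∀ u, U u = Λ (weightedDerivs 𝕜 s u) := by
  obtain ⟨s, C, -, hC⟩ := Seminorm.bound_of_continuous (schwartz_withSeminorms 𝕜 E F)
    ((normSeminorm 𝕜 𝕜).comp U.toLinearMap) U.continuous.norm
  refine ⟨s, exists_strongDual_apply_eq (weightedDerivs 𝕜 s).toLinearMap U.toLinearMap
    (C := C) fun u => (hC u).trans_eq ?_⟩
  rw [ContinuousLinearMap.coe_coe, norm_weightedDerivs]
  rfl

variable {Y : Type*} [TopologicalSpace Y]

theorem continuous_iteratedFDeriv_apply {w : Y → 𝓢(E, F)} (hw : Continuous w) (l : ℕ) (x : E) :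
    Continuous fun y => iteratedFDeriv ℝ l (w y) x := by
  have h := (lp.evalCLM ℝ (fun i : ({(0, l)} : Finset (ℕ × ℕ)) × E => E [×i.1.1.2]→L[ℝ] F) ∞
    (⟨(0, l), Finset.mem_singleton_self _⟩, x)).continuous.comp
      ((weightedDerivs ℝ {(0, l)}).continuous.comp hw)
  refine h.congr fun y => ?_
  change ‖x‖ ^ 0 • iteratedFDeriv ℝ l (w y) x = _
  rw [pow_zero, one_smul]

variable [SecondCountableTopology Y] [MeasurableSpace Y] [OpensMeasurableSpace Y] {μ : Measure Y}

theorem hasFDerivAt_integral_iteratedFDeriv {w : Y → 𝓢(E, F)} (hw : Continuous w)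
    (hint : ∀ k l, Integrable (fun y => SchwartzMap.seminorm 𝕜 k l (w y)) μ) (l : ℕ) (x : E) :
    HasFDerivAt (fun x => ∫ y, iteratedFDeriv ℝ l (w y) x ∂μ)
      (∫ y, fderiv ℝ (iteratedFDeriv ℝ l (w y)) x ∂μ) x := by
  have hmeas : ∀ l x, AEStronglyMeasurable (fun y => iteratedFDeriv ℝ l (w y) x) μ :=
    fun l x => (continuous_iteratedFDeriv_apply hw l x).aestronglyMeasurable
  refine hasFDerivAt_integral_of_dominated_of_fderiv_le (s := Set.univ)
    (F' := fun x y => fderiv ℝ (iteratedFDeriv ℝ l (w y)) x)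
    (bound := fun y => SchwartzMap.seminorm 𝕜 0 (l + 1) (w y)) Filter.univ_mem
    (.of_forall fun z => hmeas l z)
    ((hint 0 l).mono' (hmeas l x) (.of_forall fun _ =>
      SchwartzMap.norm_iteratedFDeriv_le_seminorm 𝕜 _ l x))
    ?_ (.of_forall fun y z _ => ?_) (hint 0 (l + 1)) (.of_forall fun y z _ => ?_)
  · simp_rw [fderiv_iteratedFDeriv]
    exact (LinearIsometryEquiv.continuous _).comp_aestronglyMeasurable (hmeas (l + 1) x)
  · rw [norm_fderiv_iteratedFDeriv]
    exact SchwartzMap.norm_iteratedFDeriv_le_seminorm 𝕜 _ (l + 1) z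
  · have : ContDiff ℝ 1 (iteratedFDeriv ℝ l (w y)) :=
      ((w y).smooth (l + 1 : ℕ)).iteratedFDeriv_right (by norm_cast; omega)
    exact (this.differentiable one_ne_zero z).hasFDerivAt

theorem iteratedFDeriv_integral {w : Y → 𝓢(E, F)} (hw : Continuous w)
    (hint : ∀ k l, Integrable (fun y => SchwartzMap.seminorm 𝕜 k l (w y)) μ) (l : ℕ) (x : E) :
    iteratedFDeriv ℝ l (fun x => ∫ y, w y x ∂μ) x = ∫ y, iteratedFDeriv ℝ l (w y) x ∂μ := by
  induction l generalizing x with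
  | zero =>
    exact ((continuousMultilinearCurryFin0 ℝ E F).symm.toContinuousLinearEquiv.integral_comp_comm
      fun y => w y x).symm
  | succ l ih =>
    have hsucc : ∀ g : E → F, iteratedFDeriv ℝ (l + 1) g x =
        (continuousMultilinearCurryLeftEquiv ℝ (fun _ : Fin (l + 1) => E) F).symm
          (fderiv ℝ (iteratedFDeriv ℝ l g) x) := fun g => by
      rw [iteratedFDeriv_succ_eq_comp_left]
      rfl
    simp_rw [hsucc, funext ih, (hasFDerivAt_integral_iteratedFDeriv hw hint l x).fderiv]
    exact (ContinuousLinearEquiv.integral_comp_comm (𝕜 := ℝ) (E := E →L[ℝ] (E [×l]→L[ℝ] F))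
      (F := E [×(l + 1)]→L[ℝ] F) (continuousMultilinearCurryLeftEquiv ℝ (fun _ : Fin (l + 1) => E)
      F).symm.toContinuousLinearEquiv (μ := μ)
      (fun y => fderiv ℝ (iteratedFDeriv ℝ l (w y)) x)).symm

theorem apply_eq_integral [CompleteSpace F] (U : 𝓢(E, F) →L[𝕜] 𝕜) {w : Y → 𝓢(E, F)}
    (hw : Continuous w)
    (hint : ∀ k l, Integrable (fun y => SchwartzMap.seminorm 𝕜 k l (w y)) μ)
    {W : 𝓢(E, F)} (hW : ∀ x, W x = ∫ y, w y x ∂μ) : U W = ∫ y, U (w y) ∂μ := by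
  obtain ⟨s, Λ, hΛ⟩ := exists_strongDual_weightedDerivs U
  have hi : Integrable (fun y => weightedDerivs 𝕜 s (w y)) μ := by
    refine (integrable_finsetSum s fun m _ => hint m.1 m.2).mono'
      ((weightedDerivs 𝕜 s).continuous.comp hw).aestronglyMeasurable (.of_forall fun y => ?_)
    rw [norm_weightedDerivs]
    simpa [schwartzSeminormFamily] using
      Seminorm.finset_sup_le_sum (schwartzSeminormFamily 𝕜 E F) s (w y)
  have hsW : weightedDerivs 𝕜 s W = ∫ y, weightedDerivs 𝕜 s (w y) ∂μ := by
    ext1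
    funext i
    have h := (lp.evalCLM 𝕜 (fun i : s × E => E [×i.1.1.2]→L[ℝ] F) ∞ i).integral_comp_comm hi
    refine Eq.trans ?_ h
    rw [weightedDerivs_apply, funext hW, iteratedFDeriv_integral hw hint, ← integral_smul]
    rfl
  simp_rw [hΛ, hsW, Λ.integral_comp_comm hi]

end Exchange

/-! ### Translates and products of Schwartz functions -/

theorem one_add_norm_le_mul {E : Type*} [SeminormedAddCommGroup E] (x a : E) :
    1 + ‖x‖ ≤ (1 + ‖a‖) * (1 + ‖x - a‖) := by
  nlinarith [norm_le_norm_add_norm_sub' x a, mul_nonneg (norm_nonneg a) (norm_nonneg (x - a))]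

section Translation

variable {E : Type*} [NormedAddCommGroup E] [NormedSpace ℝ E]

/-- The translate `x ↦ u (x - a)` of a Schwartz function. -/
abbrev translate (a : E) (u : 𝓢(E, ℂ)) : 𝓢(E, ℂ) := SchwartzMap.compSubConstCLM ℂ a u

/-- The pointwise product of two Schwartz functions. -/
abbrev mulS (g h : 𝓢(E, ℂ)) : 𝓢(E, ℂ) := SchwartzMap.smulLeftCLM ℂ g h

/-- The complex conjugate of a Schwartz function. -/
def conjS (u : 𝓢(E, ℂ)) : 𝓢(E, ℂ) :=
  SchwartzMap.postcompCLM (𝕜 := ℝ) (Complex.conjCLE : ℂ →L[ℝ] ℂ) u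

theorem translate_apply (a : E) (u : 𝓢(E, ℂ)) (x : E) : translate a u x = u (x - a) :=
  SchwartzMap.compSubConstCLM_apply u a x

theorem mulS_apply (g h : 𝓢(E, ℂ)) (x : E) : mulS g h x = g x * h x := by
  rw [mulS, SchwartzMap.smulLeftCLM_apply_apply g.hasTemperateGrowth, smul_eq_mul]

theorem conjS_apply (u : 𝓢(E, ℂ)) (x : E) : conjS u x = conj (u x) := rfl

theorem translate_mulS (a : E) (g h : 𝓢(E, ℂ)) :
    translate a (mulS g h) = mulS (translate a g) (translate a h) := by
  ext x
  simp only [mulS_apply, translate_apply]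

theorem mulS_comm (g h : 𝓢(E, ℂ)) : mulS g h = mulS h g := by
  ext x
  simp only [mulS_apply, mul_comm]

theorem iteratedFDeriv_translate (a : E) (u : 𝓢(E, ℂ)) (l : ℕ) (x : E) :
    iteratedFDeriv ℝ l (translate a u) x = iteratedFDeriv ℝ l u (x - a) := by
  rw [← iteratedFDeriv_comp_sub]
  rfl

theorem translate_add (a b : E) (u : 𝓢(E, ℂ)) :
    translate (a + b) u = translate a (translate b u) := by
  ext x
  simp only [translate_apply, sub_sub]

theorem mulS_translate_translate (a b : E) (g h : 𝓢(E, ℂ)) :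
    mulS (translate a g) (translate b h) = translate b (mulS (translate (a - b) g) h) := by
  rw [translate_mulS, ← translate_add, add_sub_cancel]

/-- The largest of the Schwartz seminorms with indices at most `(k, l)`. It is comparable to
`sup_x (1 + ‖x‖) ^ k ‖D ^ j u (x)‖`, `j ≤ l`, and every continuous seminorm is bounded by a
multiple of one of these. -/
def supSeminorm (k l : ℕ) : Seminorm ℂ 𝓢(E, ℂ) :=
  (Finset.Iic (k, l)).sup (schwartzSeminormFamily ℂ E ℂ)

theorem le_supSeminorm (k : ℕ) {l j : ℕ} (hj : j ≤ l) (u : 𝓢(E, ℂ)) (x : E) :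
    (1 + ‖x‖) ^ k * ‖iteratedFDeriv ℝ j u x‖ ≤ 2 ^ k * supSeminorm k l u :=
  SchwartzMap.one_add_le_sup_seminorm_apply (𝕜 := ℂ) (m := (k, l)) le_rfl hj u x

theorem supSeminorm_le_of_forall {k l : ℕ} {u : 𝓢(E, ℂ)} {M : ℝ} (hM : 0 ≤ M)
    (h : ∀ j ≤ l, ∀ x, (1 + ‖x‖) ^ k * ‖iteratedFDeriv ℝ j u x‖ ≤ M) :
    supSeminorm k l u ≤ M := by
  refine Seminorm.finset_sup_apply_le hM fun m hm => ?_
  obtain ⟨hk, hl⟩ := Finset.mem_Iic.1 hm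
  refine SchwartzMap.seminorm_le_bound ℂ _ _ _ hM fun x => le_trans ?_ (h m.2 hl x)
  gcongr
  calc ‖x‖ ^ m.1 ≤ (1 + ‖x‖) ^ m.1 := by gcongr; linarith
    _ ≤ (1 + ‖x‖) ^ k := pow_le_pow_right₀ (by linarith [norm_nonneg x]) hk

theorem continuous_supSeminorm (k l : ℕ) : Continuous (supSeminorm (E := E) k l) := by
  unfold supSeminorm
  induction Finset.Iic (k, l) using Finset.induction_on with
  | empty => exact continuous_const
  | insert m s _ ih =>
    rw [Finset.sup_insert]
    exact ((schwartz_withSeminorms ℂ E ℂ).continuous_seminorm m).sup ih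

theorem exists_le_mul_supSeminorm {p : Seminorm ℂ 𝓢(E, ℂ)} (hp : Continuous p) :
    ∃ (k l : ℕ) (C : ℝ≥0), ∀ u, p u ≤ C * supSeminorm k l u := by
  obtain ⟨s, C, -, hC⟩ := Seminorm.bound_of_continuous (schwartz_withSeminorms ℂ E ℂ) p hp
  refine ⟨s.sup Prod.fst, s.sup Prod.snd, C, fun u => (hC u).trans ?_⟩
  refine mul_le_mul_of_nonneg_left (Finset.sup_mono (f := schwartzSeminormFamily ℂ E ℂ)
    (fun m hm => ?_) u) C.2
  exact Finset.mem_Iic.2 ⟨Finset.le_sup hm, Finset.le_sup hm⟩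

theorem supSeminorm_translate_le (k l : ℕ) (a : E) (u : 𝓢(E, ℂ)) :
    supSeminorm k l (translate a u) ≤ (1 + ‖a‖) ^ k * (2 ^ k * supSeminorm k l u) := by
  refine supSeminorm_le_of_forall (by positivity) fun j hj x => ?_
  rw [iteratedFDeriv_translate]
  calc (1 + ‖x‖) ^ k * ‖iteratedFDeriv ℝ j u (x - a)‖
      ≤ ((1 + ‖a‖) * (1 + ‖x - a‖)) ^ k * ‖iteratedFDeriv ℝ j u (x - a)‖ := by
        gcongr
        exact one_add_norm_le_mul x a
    _ = (1 + ‖a‖) ^ k * ((1 + ‖x - a‖) ^ k * ‖iteratedFDeriv ℝ j u (x - a)‖) := by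
        rw [mul_pow, mul_assoc]
    _ ≤ _ := mul_le_mul_of_nonneg_left (le_supSeminorm k hj u _) (by positivity)

theorem exists_translate_le {p : Seminorm ℂ 𝓢(E, ℂ)} (hp : Continuous p) (u : 𝓢(E, ℂ)) :
    ∃ (C : ℝ) (k : ℕ), ∀ a, p (translate a u) ≤ C * (1 + ‖a‖) ^ k := by
  obtain ⟨k, l, C, hC⟩ := exists_le_mul_supSeminorm hp
  refine ⟨C * (2 ^ k * supSeminorm k l u), k, fun a => ?_⟩
  calc p (translate a u) ≤ C * ((1 + ‖a‖) ^ k * (2 ^ k * supSeminorm k l u)) :=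
        (hC _).trans (mul_le_mul_of_nonneg_left (supSeminorm_translate_le k l a u) C.2)
    _ = _ := by ring

theorem norm_iteratedFDeriv_translate_sub_le {k j l : ℕ} (hj : j ≤ l) {a : E} (ha : ‖a‖ ≤ 1)
    (u : 𝓢(E, ℂ)) (x : E) :
    ‖iteratedFDeriv ℝ j u (x - a) - iteratedFDeriv ℝ j u x‖ ≤
      2 ^ k * (2 ^ k * supSeminorm k (l + 1) u) / (1 + ‖x‖) ^ k * ‖a‖ := by
  have hderiv : ∀ z ∈ Metric.closedBall x 1, ‖fderiv ℝ (iteratedFDeriv ℝ j u) z‖ ≤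
      2 ^ k * (2 ^ k * supSeminorm k (l + 1) u) / (1 + ‖x‖) ^ k := fun z hz => by
    have hxz : ‖x - z‖ ≤ 1 := by simpa [dist_eq_norm, norm_sub_rev] using hz
    have hx : 1 + ‖x‖ ≤ 2 * (1 + ‖z‖) := by
      linarith [norm_nonneg z, norm_le_norm_add_norm_sub' x z]
    rw [norm_fderiv_iteratedFDeriv, le_div_iff₀' (by positivity)]
    calc (1 + ‖x‖) ^ k * ‖iteratedFDeriv ℝ (j + 1) u z‖
        ≤ (2 * (1 + ‖z‖)) ^ k * ‖iteratedFDeriv ℝ (j + 1) u z‖ := by gcongr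
      _ = 2 ^ k * ((1 + ‖z‖) ^ k * ‖iteratedFDeriv ℝ (j + 1) u z‖) := by
          rw [mul_pow, mul_assoc]
      _ ≤ _ := mul_le_mul_of_nonneg_left (le_supSeminorm k (by omega) u z) (by positivity)
  have hdiff : Differentiable ℝ (iteratedFDeriv ℝ j u) :=
    ((u.smooth (j + 1 : ℕ)).iteratedFDeriv_right (m := 1) (by norm_cast; omega)).differentiable
      one_ne_zero
  simpa using (convex_closedBall x 1).norm_image_sub_le_of_norm_fderiv_le (𝕜 := ℝ)
    (fun z _ => hdiff z) hderiv (Metric.mem_closedBall_self zero_le_one)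
    (y := x - a) (by simpa [dist_eq_norm] using ha)

theorem supSeminorm_translate_sub_le (k l : ℕ) {a : E} (ha : ‖a‖ ≤ 1) (u : 𝓢(E, ℂ)) :
    supSeminorm k l (translate a u - u) ≤
      ‖a‖ * (2 ^ k * (2 ^ k * supSeminorm k (l + 1) u)) := by
  refine supSeminorm_le_of_forall (by positivity) fun j hj x => ?_
  have hsub : iteratedFDeriv ℝ j (translate a u - u : 𝓢(E, ℂ)) x =
      iteratedFDeriv ℝ j u (x - a) - iteratedFDeriv ℝ j u x := by
    rw [← iteratedFDeriv_translate]
    exact iteratedFDeriv_sub_apply ((translate a u).smooth _).contDiffAt (u.smooth _).contDiffAt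
  rw [hsub, ← le_div_iff₀' (by positivity)]
  exact (norm_iteratedFDeriv_translate_sub_le hj ha u x).trans_eq (by ring)

theorem continuous_translate : Continuous fun z : E × 𝓢(E, ℂ) => translate z.1 z.2 := by
  refine continuous_iff_continuousAt.2 fun ⟨a₀, u₀⟩ => ?_
  refine ((schwartz_withSeminorms ℂ E ℂ).tendsto_nhds _ _).2 fun ⟨k, l⟩ ε hε => ?_
  set B : E × 𝓢(E, ℂ) → ℝ := fun z => (1 + ‖z.1‖) ^ k * (2 ^ k * supSeminorm k l (z.2 - u₀)) +
    ‖z.1 - a₀‖ * (2 ^ k * (2 ^ k * supSeminorm k (l + 1) (translate a₀ u₀))) with hB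
  have hle : ∀ z : E × 𝓢(E, ℂ), ‖z.1 - a₀‖ ≤ 1 →
      supSeminorm k l (translate z.1 z.2 - translate a₀ u₀) ≤ B z := fun ⟨a, u⟩ ha => by
    have hsplit : translate a u - translate a₀ u₀ =
        translate a (u - u₀) + (translate (a - a₀) (translate a₀ u₀) - translate a₀ u₀) := by
      rw [← translate_add, sub_add_cancel, translate, translate, translate, map_sub]
      abel
    rw [hsplit]
    exact (map_add_le_add _ _ _).trans (add_le_add (supSeminorm_translate_le k l a _)
      (supSeminorm_translate_sub_le k l ha _))
  have hBcont : Continuous B := by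
    have := (continuous_supSeminorm (E := E) k l).comp
      ((continuous_snd (X := E) (Y := 𝓢(E, ℂ))).sub (continuous_const (y := u₀)))
    simp only [Function.comp_def] at this
    fun_prop
  have hB₀ : B (a₀, u₀) < ε := by simpa [hB] using hε
  have hnear : ∀ᶠ z : E × 𝓢(E, ℂ) in nhds (a₀, u₀), ‖z.1 - a₀‖ ≤ 1 := by
    have hc : Continuous fun z : E × 𝓢(E, ℂ) => ‖z.1 - a₀‖ := by fun_prop
    exact (hc.tendsto (a₀, u₀)).eventually_le_const (by simp)
  filter_upwards [hnear, (hBcont.tendsto (a₀, u₀)).eventually_lt_const hB₀] with z h1 h2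
  exact (Seminorm.le_finset_sup_apply (p := schwartzSeminormFamily ℂ E ℂ)
    (Finset.mem_Iic.2 le_rfl)).trans_lt ((hle z h1).trans_lt h2)

theorem continuous_translate_left (u : 𝓢(E, ℂ)) : Continuous fun a => translate a u := by
  have h := (continuous_translate (E := E)).comp (f := fun a : E => (a, u)) (by fun_prop)
  simpa only [Function.comp_def] using h

theorem supSeminorm_mulS_translate_le (g h : 𝓢(E, ℂ)) (N k l : ℕ) (a : E) :
    (1 + ‖a‖) ^ N * supSeminorm k l (mulS (translate a g) h) ≤
      2 ^ l * ((2 ^ N * supSeminorm N l g) * (2 ^ (N + k) * supSeminorm (N + k) l h)) := by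
  set B := (2 ^ N * supSeminorm N l g) * (2 ^ (N + k) * supSeminorm (N + k) l h)
  have : 0 ≤ B := by positivity
  rw [← le_div_iff₀' (by positivity)]
  refine supSeminorm_le_of_forall (by positivity) fun j hj x => ?_
  rw [le_div_iff₀' (by positivity)]
  have hmul : (mulS (translate a g) h : E → ℂ) = fun y => translate a g y * h y :=
    funext fun y => mulS_apply _ _ y
  have ha : 1 + ‖a‖ ≤ (1 + ‖x‖) * (1 + ‖x - a‖) := by
    simpa only [norm_sub_rev a x] using one_add_norm_le_mul a x
  calc (1 + ‖a‖) ^ N * ((1 + ‖x‖) ^ k * ‖iteratedFDeriv ℝ j (mulS (translate a g) h) x‖)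
      ≤ ((1 + ‖x‖) * (1 + ‖x - a‖)) ^ N * ((1 + ‖x‖) ^ k * ∑ i ∈ Finset.range (j + 1),
        (j.choose i : ℝ) * ‖iteratedFDeriv ℝ i (translate a g) x‖ *
          ‖iteratedFDeriv ℝ (j - i) h x‖) := by
        rw [hmul]
        gcongr
        exact norm_iteratedFDeriv_mul_le ((translate a g).smooth j) (h.smooth j) x le_rfl
    _ = ∑ i ∈ Finset.range (j + 1), (j.choose i : ℝ) *
        (((1 + ‖x - a‖) ^ N * ‖iteratedFDeriv ℝ i g (x - a)‖) *
          ((1 + ‖x‖) ^ (N + k) * ‖iteratedFDeriv ℝ (j - i) h x‖)) := by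
        rw [Finset.mul_sum, Finset.mul_sum]
        refine Finset.sum_congr rfl fun i _ => ?_
        rw [iteratedFDeriv_translate, mul_pow, pow_add]
        ring
    _ ≤ ∑ i ∈ Finset.range (j + 1), (j.choose i : ℝ) * B := by
        refine Finset.sum_le_sum fun i hi => mul_le_mul_of_nonneg_left ?_ (by positivity)
        exact mul_le_mul
          (le_supSeminorm N ((Finset.mem_range_succ_iff.1 hi).trans hj) g _)
          (le_supSeminorm (N + k) ((Nat.sub_le _ _).trans hj) h _) (by positivity) (by positivity)
    _ = 2 ^ j * B := by
        rw [← Finset.sum_mul, ← Nat.cast_sum, Nat.sum_range_choose]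
        norm_cast
    _ ≤ 2 ^ l * B := by
        gcongr
        norm_num

theorem exists_mulS_translate_le {p : Seminorm ℂ 𝓢(E, ℂ)} (hp : Continuous p)
    (g h : 𝓢(E, ℂ)) (N : ℕ) :
    ∃ C : ℝ, ∀ a, (1 + ‖a‖) ^ N * p (mulS (translate a g) h) ≤ C := by
  obtain ⟨k, l, C, hC⟩ := exists_le_mul_supSeminorm hp
  refine ⟨C * (2 ^ l * ((2 ^ N * supSeminorm N l g) * (2 ^ (N + k) * supSeminorm (N + k) l h))),
    fun a => ?_⟩
  calc (1 + ‖a‖) ^ N * p (mulS (translate a g) h)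
      ≤ (1 + ‖a‖) ^ N * (C * supSeminorm k l (mulS (translate a g) h)) := by
        gcongr
        exact hC _
    _ = C * ((1 + ‖a‖) ^ N * supSeminorm k l (mulS (translate a g) h)) := by ring
    _ ≤ _ := mul_le_mul_of_nonneg_left (supSeminorm_mulS_translate_le g h N k l a) C.2

end Translation

/-! ### Modulations and the Fourier transform -/

theorem integrable_norm_mul_one_add_norm_pow {E F : Type*} [NormedAddCommGroup E] [NormedSpace ℝ E]
    [NormedAddCommGroup F] [NormedSpace ℝ F] [MeasurableSpace E] [BorelSpace E]
    [SecondCountableTopology E] {μ : Measure E} [μ.HasTemperateGrowth] (u : 𝓢(E, F)) (k : ℕ) :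
    Integrable (fun x => ‖u x‖ * (1 + ‖x‖) ^ k) μ := by
  have hexpand : ∀ x, ‖u x‖ * (1 + ‖x‖) ^ k =
      ∑ j ∈ Finset.range (k + 1), (k.choose j : ℝ) * (‖x‖ ^ j * ‖u x‖) := fun x => by
    rw [add_comm, add_pow, Finset.mul_sum]
    refine Finset.sum_congr rfl fun j _ => ?_
    rw [one_pow]
    ring
  simp_rw [hexpand]
  exact integrable_finsetSum _ fun j _ => (u.integrable_pow_mul μ j).const_mul _

section Fourier

variable {n : ℕ}

local notation "𝔼" => EuclideanSpace ℝ (Fin n)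

theorem normFactor_sq_mul (n : ℕ) :
    normFactor n * normFactor n * (((2 * Real.pi) ^ n : ℝ) : ℂ) = 1 := by
  have hpos : (0 : ℝ) < 2 * Real.pi := by positivity
  rw [normFactor, ← Complex.ofReal_mul, ← Complex.ofReal_mul, ← Real.rpow_add hpos,
    ← Real.rpow_natCast (2 * Real.pi) n, ← Real.rpow_add hpos, ← Complex.ofReal_one]
  congr 1
  rw [← Real.rpow_zero (2 * Real.pi)]
  congr 1
  ring

theorem apply_eq_integral_fourier (u : 𝓢(𝔼, ℂ)) (x : 𝔼) :
    u x = ∫ η, (𝓕 u) η * Complex.exp (Complex.I * (inner ℝ x ((2 * Real.pi) • η) : ℝ)) := by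
  have hinv : u x = (𝓕⁻ (𝓕 u)) x := by rw [FourierTransform.fourierInv_fourier_eq]
  rw [hinv, SchwartzMap.fourierInv_coe, Real.fourierInv_eq']
  congr 1
  ext η
  rw [smul_eq_mul, real_inner_smul_right, real_inner_comm, mul_comm]
  congr 2
  push_cast
  ring

theorem fourierInvS_fourierS (u : 𝓢(𝔼, ℂ)) : fourierInvS n (fourierS n u) = u := by
  ext x
  set g : 𝔼 → ℂ := fun η =>
    (𝓕 u) η * Complex.exp (Complex.I * (inner ℝ x ((2 * Real.pi) • η) : ℝ)) with hg
  have hint : ∀ ξ, fourierS n u ξ * Complex.exp (Complex.I * (inner ℝ x ξ : ℝ)) =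
      normFactor n * g ((2 * Real.pi)⁻¹ • ξ) := fun ξ => by
    have hξ : fourierS n u ξ = normFactor n * (𝓕 u) ((2 * Real.pi)⁻¹ • ξ) := rfl
    simp only [hξ, hg]
    rw [smul_inv_smul₀ (by positivity), mul_assoc]
  have hscale := Measure.integral_comp_smul (μ := (volume : Measure 𝔼)) g (2 * Real.pi)⁻¹
  rw [finrank_euclideanSpace_fin, inv_pow, inv_inv, abs_of_pos (by positivity),
    Complex.real_smul, hg, ← apply_eq_integral_fourier u x] at hscale
  rw [fourierInvS_apply]
  simp_rw [hint]
  rw [integral_const_mul, hscale, ← mul_assoc, ← mul_assoc, normFactor_sq_mul, one_mul]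

theorem norm_character (ξ x : 𝔼) : ‖character ξ x‖ = 1 := by
  rw [character, Complex.norm_exp]
  simp

/-- The product `η ↦ e^{i η·x} m(η)`. -/
def modulate (x : 𝔼) (m : 𝓢(𝔼, ℂ)) : 𝓢(𝔼, ℂ) := SchwartzMap.smulLeftCLM ℂ (character (-x)) m

theorem modulate_apply (x : 𝔼) (m : 𝓢(𝔼, ℂ)) (η : 𝔼) :
    modulate x m η = Complex.exp (Complex.I * (inner ℝ η x : ℝ)) * m η := by
  rw [modulate, SchwartzMap.smulLeftCLM_apply_apply (character_hasTemperateGrowth _), smul_eq_mul,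
    character, inner_neg_right]
  push_cast
  ring_nf

theorem norm_modulate_apply (x : 𝔼) (m : 𝓢(𝔼, ℂ)) (η : 𝔼) : ‖modulate x m η‖ = ‖m η‖ := by
  rw [modulate, SchwartzMap.smulLeftCLM_apply_apply (character_hasTemperateGrowth _), norm_smul,
    norm_character, one_mul]

theorem modulate_modulate (x y : 𝔼) (m : 𝓢(𝔼, ℂ)) :
    modulate x (modulate y m) = modulate (x + y) m := by
  ext η
  simp only [modulate_apply, inner_add_right, Complex.ofReal_add, mul_add, Complex.exp_add]
  ring

theorem modulate_mulS (x : 𝔼) (g m : 𝓢(𝔼, ℂ)) :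
    modulate x (mulS g m) = mulS (modulate x m) g := by
  ext η
  simp only [modulate_apply, mulS_apply]
  ring

theorem fourierS_modulate (x : 𝔼) (m : 𝓢(𝔼, ℂ)) :
    fourierS n (modulate x m) = translate x (fourierS n m) := by
  ext ξ
  rw [translate_apply, fourierS_apply, fourierS_apply]
  congr 2
  ext η
  rw [modulate_apply, mul_comm (Complex.exp _), mul_assoc, ← Complex.exp_add, inner_sub_right]
  push_cast
  ring_nf

theorem fourierS_translate (x : 𝔼) (u : 𝓢(𝔼, ℂ)) :
    fourierS n (translate x u) = modulate (-x) (fourierS n u) := by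
  ext ξ
  rw [modulate_apply, fourierS_apply, fourierS_apply, mul_left_comm]
  refine congrArg (normFactor n * ·) ?_
  rw [← integral_const_mul, ← integral_add_right_eq_self _ x]
  refine integral_congr_ae (.of_forall fun η => ?_)
  dsimp only
  rw [translate_apply, add_sub_cancel_right, mul_left_comm, ← Complex.exp_add, inner_add_left,
    inner_neg_right, real_inner_comm ξ x]
  push_cast
  ring_nf

theorem fourierS_conjS (u : 𝓢(𝔼, ℂ)) : fourierS n (conjS u) = conjS (fourierInvS n u) := by
  ext ξ
  have hexp : ∀ r : ℝ, Complex.exp (-Complex.I * r) = conj (Complex.exp (Complex.I * r)) :=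
    fun r => by simp [← Complex.exp_conj]
  have hfactor : conj (normFactor n) = normFactor n := Complex.conj_ofReal _
  rw [conjS_apply, fourierS_apply, fourierInvS_apply, map_mul, hfactor, ← integral_conj]
  simp_rw [map_mul, conjS_apply, hexp, real_inner_comm ξ]

theorem timeFreqShift_eq (φ : 𝓢(𝔼, ℂ)) (x ξ : 𝔼) :
    timeFreqShift φ x ξ = character ξ x •
      fourierS n (modulate x (translate ξ (conjS (fourierS n φ)))) := by
  rw [fourierS_modulate, fourierS_translate, fourierS_conjS, fourierInvS_fourierS]
  ext t
  rw [timeFreqShift_apply, smul_apply, translate_apply, modulate_apply, conjS_apply, smul_eq_mul,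
    character, ← mul_assoc, ← Complex.exp_add, mul_comm, inner_neg_right, inner_sub_left]
  push_cast
  ring_nf

theorem enorm_stft (φ : 𝓢(𝔼, ℂ)) (f : 𝓢'(𝔼, ℂ)) (x ξ : 𝔼) :
    ‖stft φ f x ξ‖ₑ =
      ‖normFactor n‖ₑ * ‖fourierD n f (modulate x (translate ξ (conjS (fourierS n φ))))‖ₑ := by
  have hchar : ‖character ξ x‖ₑ = 1 := by
    rw [← ofReal_norm, norm_character, ENNReal.ofReal_one]
  rw [stft, timeFreqShift_eq, map_smul, smul_eq_mul, enorm_mul, enorm_mul, hchar, one_mul]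
  rfl

theorem modulate_eq_fourierInvS (x : 𝔼) (m : 𝓢(𝔼, ℂ)) :
    modulate x m = fourierInvS n (translate x (fourierS n m)) := by
  rw [← fourierS_modulate, fourierInvS_fourierS]

theorem continuous_modulate : Continuous fun z : 𝔼 × 𝓢(𝔼, ℂ) => modulate z.1 z.2 := by
  simp_rw [modulate_eq_fourierInvS]
  exact (fourierInvS n).continuous.comp (continuous_translate.comp
    (continuous_fst.prodMk ((fourierS n).continuous.comp continuous_snd)))

theorem continuous_modulate_left (m : 𝓢(𝔼, ℂ)) : Continuous fun x => modulate x m := by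
  have h := (continuous_modulate (n := n)).comp (f := fun x : 𝔼 => (x, m)) (by fun_prop)
  simpa only [Function.comp_def] using h

theorem exists_modulate_le {p : Seminorm ℂ 𝓢(𝔼, ℂ)} (hp : Continuous p) (m : 𝓢(𝔼, ℂ)) :
    ∃ (C : ℝ) (k : ℕ), ∀ x, p (modulate x m) ≤ C * (1 + ‖x‖) ^ k := by
  simp_rw [modulate_eq_fourierInvS]
  exact exists_translate_le (p := p.comp (fourierInvS n).toLinearMap)
    (hp.comp (fourierInvS n).continuous) (fourierS n m)

theorem apply_mulS_fourierInvS (U : 𝓢(𝔼, ℂ) →L[ℂ] ℂ) (m u : 𝓢(𝔼, ℂ)) :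
    U (mulS m (fourierInvS n u)) = normFactor n * ∫ y, u y * U (modulate y m) := by
  have hmod := continuous_modulate_left m
  have hcont : Continuous fun y : 𝔼 => (normFactor n * u y) • modulate y m :=
    (continuous_const.mul u.continuous).smul hmod
  have hint : ∀ k l, Integrable
      (fun y : 𝔼 => SchwartzMap.seminorm ℂ k l ((normFactor n * u y) • modulate y m)) := by
    intro k l
    have hp := (schwartz_withSeminorms ℂ 𝔼 ℂ).continuous_seminorm (k, l)
    obtain ⟨C, J, hCJ⟩ := exists_modulate_le hp m
    refine ((integrable_norm_mul_one_add_norm_pow u J).const_mul (‖normFactor n‖ * C)).mono'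
      (hp.comp hcont).aestronglyMeasurable (.of_forall fun y => ?_)
    rw [Real.norm_of_nonneg (apply_nonneg _ _), map_smul_eq_mul, norm_mul]
    calc _ ≤ ‖normFactor n‖ * ‖u y‖ * (C * (1 + ‖y‖) ^ J) := by
          gcongr
          exact hCJ y
      _ = _ := by ring
  have hW : ∀ x, mulS m (fourierInvS n u) x =
      ∫ y, ((normFactor n * u y) • modulate y m) x := by
    intro x
    rw [mulS_apply, fourierInvS_apply, mul_left_comm, ← integral_const_mul, ← integral_const_mul]
    congr 1
    ext y
    rw [smul_apply, smul_eq_mul, modulate_apply, real_inner_comm]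
    ring
  rw [apply_eq_integral U hcont hint hW, ← integral_const_mul]
  simp_rw [map_smul, smul_eq_mul, mul_assoc]

theorem enorm_apply_modulate_mulS_le (U : 𝓢(𝔼, ℂ) →L[ℂ] ℂ) (g m : 𝓢(𝔼, ℂ)) (x : 𝔼) :
    ‖U (modulate x (mulS g m))‖ₑ ≤
      ‖normFactor n‖ₑ * ∫⁻ y, ‖fourierS n g y‖ₑ * ‖U (modulate (x + y) m)‖ₑ := by
  calc ‖U (modulate x (mulS g m))‖ₑ
      = ‖normFactor n‖ₑ * ‖∫ y, fourierS n g y * U (modulate (x + y) m)‖ₑ := by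
        rw [modulate_mulS, ← fourierInvS_fourierS g, apply_mulS_fourierInvS, enorm_mul,
          fourierInvS_fourierS]
        simp_rw [modulate_modulate, add_comm x]
    _ ≤ _ := by
        gcongr
        exact (enorm_integral_le_lintegral_enorm _).trans_eq (by simp_rw [enorm_mul])

end Fourier

/-! ### Integral inequalities -/

section Inequalities

variable {X Y : Type*} [MeasurableSpace X] [MeasurableSpace Y] {μ : Measure X} {ν : Measure Y}

theorem lintegral_mul_rpow_le {k F : Y → ℝ≥0∞} (hk : Measurable k) (hF : Measurable F)
    {r : ℝ} (hr : 1 ≤ r) :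
    (∫⁻ y, k y * F y ∂ν) ^ r ≤ (∫⁻ y, k y ∂ν) ^ (r - 1) * ∫⁻ y, k y * F y ^ r ∂ν := by
  have hr₀ : 0 < r := by linarith
  have hr₁ : 0 ≤ 1 - 1 / r := sub_nonneg.2 (by rwa [div_le_one hr₀])
  have hexp : (1 - 1 / r) * r = r - 1 := by field_simp
  have hsplit : ∀ y, k y * F y = k y ^ (1 - 1 / r) * (k y * F y ^ r) ^ (1 / r) := fun y => by
    rw [ENNReal.mul_rpow_of_nonneg _ _ (by positivity : 0 ≤ 1 / r), ← mul_assoc,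
      ← ENNReal.rpow_add_of_nonneg _ _ hr₁ (by positivity), ← ENNReal.rpow_mul,
      mul_one_div_cancel hr₀.ne', sub_add_cancel, ENNReal.rpow_one, ENNReal.rpow_one]
  have hHolder := ENNReal.lintegral_mul_norm_pow_le (μ := ν) hk.aemeasurable
    (hk.mul (hF.pow_const r)).aemeasurable (p := 1 - 1 / r) (q := 1 / r) hr₁ (by positivity)
    (by ring)
  simp only [Pi.mul_apply, ← hsplit] at hHolder
  calc (∫⁻ y, k y * F y ∂ν) ^ r
      ≤ ((∫⁻ y, k y ∂ν) ^ (1 - 1 / r) * (∫⁻ y, k y * F y ^ r ∂ν) ^ (1 / r)) ^ r := by gcongr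
    _ = _ := by
      rw [ENNReal.mul_rpow_of_nonneg _ _ hr₀.le, ← ENNReal.rpow_mul, ← ENNReal.rpow_mul,
        one_div_mul_cancel hr₀.ne', ENNReal.rpow_one, hexp]

theorem lintegral_rpow_lintegral_mul_le {k F : X → Y → ℝ≥0∞} [SFinite ν]
    (hk : Measurable (Function.uncurry k)) (hF : Measurable (Function.uncurry F)) {A : ℝ≥0∞}
    (hA : ∀ x, ∫⁻ y, k x y ∂ν ≤ A) {r : ℝ} (hr : 1 ≤ r) :
    ∫⁻ x, (∫⁻ y, k x y * F x y ∂ν) ^ r ∂μ ≤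
      A ^ (r - 1) * ∫⁻ x, ∫⁻ y, k x y * F x y ^ r ∂ν ∂μ := by
  have hmeas : Measurable fun x => ∫⁻ y, k x y * F x y ^ r ∂ν :=
    Measurable.lintegral_prod_right' (f := fun z : X × Y => k z.1 z.2 * F z.1 z.2 ^ r)
      (hk.mul (hF.pow_const r))
  rw [← lintegral_const_mul _ hmeas]
  refine lintegral_mono fun x => ?_
  calc (∫⁻ y, k x y * F x y ∂ν) ^ r
      ≤ (∫⁻ y, k x y ∂ν) ^ (r - 1) * ∫⁻ y, k x y * F x y ^ r ∂ν :=
        lintegral_mul_rpow_le hk.of_uncurry_left hF.of_uncurry_left hr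
    _ ≤ _ := mul_le_mul' (ENNReal.rpow_le_rpow (hA x) (sub_nonneg.2 hr)) le_rfl

theorem rpow_sub_one_mul_self {A : ℝ≥0∞} {r : ℝ} (hr : 1 ≤ r) : A ^ (r - 1) * A = A ^ r := by
  nth_rewrite 2 [← ENNReal.rpow_one A]
  rw [← ENNReal.rpow_add_of_nonneg _ _ (by linarith) zero_le_one, sub_add_cancel]

theorem one_le_toReal {q : ℝ≥0∞} (hq : 1 ≤ q) (hq' : q ≠ ∞) : 1 ≤ q.toReal := by
  rw [← ENNReal.toReal_one]
  exact ENNReal.toReal_mono hq' hq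

theorem eLpNorm_rpow_toReal {F : X → ℝ≥0∞} {q : ℝ≥0∞} (hq : 1 ≤ q) (hq' : q ≠ ∞) :
    eLpNorm F q μ ^ q.toReal = ∫⁻ x, F x ^ q.toReal ∂μ := by
  rw [eLpNorm_eq_lintegral_rpow_enorm_toReal (one_pos.trans_le hq).ne' hq', ← ENNReal.rpow_mul,
    one_div_mul_cancel (one_pos.trans_le (one_le_toReal hq hq')).ne', ENNReal.rpow_one]
  simp only [enorm_eq_self]

theorem ae_le_eLpNorm_top (F : X → ℝ≥0∞) : ∀ᵐ x ∂μ, F x ≤ eLpNorm F ∞ μ := by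
  rw [eLpNorm_exponent_top]
  exact enorm_ae_le_eLpNormEssSup F μ

theorem eLpNorm_top_le {F : X → ℝ≥0∞} {c : ℝ≥0∞} (h : ∀ᵐ x ∂μ, F x ≤ c) :
    eLpNorm F ∞ μ ≤ c := by
  rw [eLpNorm_exponent_top]
  exact essSup_le_of_ae_le _ h

/-- **Schur's test**. -/
theorem eLpNorm_lintegral_mul_le [SFinite μ] [SFinite ν] {k : X → Y → ℝ≥0∞}
    (hk : Measurable (Function.uncurry k)) {F : Y → ℝ≥0∞} (hF : Measurable F) {A : ℝ≥0∞}
    (hA₁ : ∀ x, ∫⁻ y, k x y ∂ν ≤ A) (hA₂ : ∀ y, ∫⁻ x, k x y ∂μ ≤ A) {q : ℝ≥0∞} (hq : 1 ≤ q) :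
    eLpNorm (fun x => ∫⁻ y, k x y * F y ∂ν) q μ ≤ A * eLpNorm F q ν := by
  rcases eq_or_ne q ∞ with rfl | hq'
  · refine eLpNorm_top_le (.of_forall fun x => ?_)
    calc ∫⁻ y, k x y * F y ∂ν ≤ ∫⁻ y, k x y * eLpNorm F ∞ ν ∂ν := by
          refine lintegral_mono_ae ?_
          filter_upwards [ae_le_eLpNorm_top F] with y hy
          gcongr
      _ = (∫⁻ y, k x y ∂ν) * eLpNorm F ∞ ν := lintegral_mul_const _ hk.of_uncurry_left
      _ ≤ A * eLpNorm F ∞ ν := by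
          gcongr
          exact hA₁ x
  · have hr := one_le_toReal hq hq'
    have hF' : Measurable (Function.uncurry fun (_ : X) y => F y) := hF.comp measurable_snd
    have hmeas : Measurable (Function.uncurry fun x y => k x y * F y ^ q.toReal) :=
      hk.mul (hF'.pow_const _)
    rw [← ENNReal.rpow_le_rpow_iff (one_pos.trans_le hr), eLpNorm_rpow_toReal hq hq',
      ENNReal.mul_rpow_of_nonneg _ _ (zero_le_one.trans hr), eLpNorm_rpow_toReal hq hq',
      ← rpow_sub_one_mul_self hr, mul_assoc]
    refine (lintegral_rpow_lintegral_mul_le hk hF' hA₁ hr).trans ?_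
    gcongr
    rw [lintegral_lintegral_swap hmeas.aemeasurable, ← lintegral_const_mul _ (hF.pow_const _)]
    refine lintegral_mono fun y => ?_
    rw [lintegral_mul_const _ hk.of_uncurry_right]
    gcongr
    exact hA₂ y

theorem measurable_eLpNorm_left [SFinite μ] {H : X → Y → ℝ≥0∞}
    (hH : Measurable (Function.uncurry H)) {p : ℝ≥0∞} (hp : 1 ≤ p) :
    Measurable fun y => eLpNorm (fun x => H x y) p μ := by
  rcases eq_or_ne p ∞ with rfl | hp'
  · refine measurable_of_Ioi fun c => ?_
    have hset : (fun y => eLpNorm (fun x => H x y) ∞ μ) ⁻¹' Set.Ioi c =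
        {y | μ {x | c < H x y} ≠ 0} := by
      ext y
      have hnull : μ {x | c < H x y} = 0 ↔ ∀ᵐ x ∂μ, H x y ≤ c := by
        simp only [ae_iff, not_le]
      rw [Set.mem_preimage, Set.mem_Ioi, Set.mem_ofPred_eq, ← not_le, not_iff_not, hnull]
      refine ⟨fun h => ?_, eLpNorm_top_le⟩
      filter_upwards [ae_le_eLpNorm_top fun x => H x y] with x hx using hx.trans h
    rw [hset]
    exact (measurable_measure_prodMk_right (hH measurableSet_Ioi))
      (measurableSet_singleton 0).compl
  · simp only [eLpNorm_eq_lintegral_rpow_enorm_toReal (one_pos.trans_le hp).ne' hp', enorm_eq_self]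
    exact (Measurable.lintegral_prod_left' (hH.pow_const _)).pow_const _

/-- Normalising each slice by its norm exhibits the integrand of Minkowski's inequality as a
kernel of the kind treated by `lintegral_rpow_lintegral_mul_le`. -/
theorem ae_le_eLpNorm_mul_inv_mul [SFinite μ] [SFinite ν] {H : X → Y → ℝ≥0∞}
    (hH : Measurable (Function.uncurry H)) {p : ℝ≥0∞} (hp : 1 ≤ p)
    (hfin : ∫⁻ y, eLpNorm (fun x => H x y) p μ ∂ν ≠ ∞) :
    ∀ᵐ x ∂μ, ∀ᵐ y ∂ν, H x y ≤
      eLpNorm (fun x' => H x' y) p μ * ((eLpNorm (fun x' => H x' y) p μ)⁻¹ * H x y) := by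
  have hN := measurable_eLpNorm_left (μ := μ) hH hp
  have hmeas : MeasurableSet {z : X × Y | H z.1 z.2 ≤ eLpNorm (fun x' => H x' z.2) p μ *
      ((eLpNorm (fun x' => H x' z.2) p μ)⁻¹ * H z.1 z.2)} :=
    measurableSet_le hH ((hN.comp measurable_snd).mul ((hN.comp measurable_snd).inv.mul hH))
  rw [Measure.ae_ae_comm hmeas]
  filter_upwards [ae_lt_top hN hfin] with y hy
  rcases eq_or_ne (eLpNorm (fun x => H x y) p μ) 0 with hzero | hzero
  · have hHzero := (eLpNorm_eq_zero_iff hH.of_uncurry_right.aestronglyMeasurable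
      (one_pos.trans_le hp).ne').1 hzero
    filter_upwards [hHzero] with x hx
    simp only [hx, Pi.zero_apply, zero_le]
  · refine .of_forall fun x => ?_
    rw [← mul_assoc, ENNReal.mul_inv_cancel hzero hy.ne, one_mul]

theorem lintegral_inv_eLpNorm_mul_rpow_le {F : X → ℝ≥0∞} (hF : Measurable F) {p : ℝ≥0∞}
    (hp : 1 ≤ p) (hp' : p ≠ ∞) : ∫⁻ x, ((eLpNorm F p μ)⁻¹ * F x) ^ p.toReal ∂μ ≤ 1 := by
  have hr : 0 ≤ p.toReal := zero_le_one.trans (one_le_toReal hp hp')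
  simp_rw [ENNReal.mul_rpow_of_nonneg _ _ hr]
  rw [lintegral_const_mul _ (hF.pow_const _), ← eLpNorm_rpow_toReal hp hp',
    ← ENNReal.mul_rpow_of_nonneg _ _ hr]
  exact ENNReal.rpow_le_one (ENNReal.inv_mul_le_one _) hr

/-- **Minkowski's integral inequality**. -/
theorem eLpNorm_lintegral_le [SFinite μ] [SFinite ν] {H : X → Y → ℝ≥0∞}
    (hH : Measurable (Function.uncurry H)) {p : ℝ≥0∞} (hp : 1 ≤ p) :
    eLpNorm (fun x => ∫⁻ y, H x y ∂ν) p μ ≤ ∫⁻ y, eLpNorm (fun x => H x y) p μ ∂ν := by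
  set N : Y → ℝ≥0∞ := fun y => eLpNorm (fun x => H x y) p μ with hNdef
  have hN : Measurable N := measurable_eLpNorm_left hH hp
  rcases eq_or_ne (∫⁻ y, N y ∂ν) ∞ with htop | hfin
  · exact htop ▸ le_top
  rcases eq_or_ne p ∞ with rfl | hp'
  · refine eLpNorm_top_le ?_
    have hswap : ∀ᵐ x ∂μ, ∀ᵐ y ∂ν, H x y ≤ N y := by
      have hmeas : MeasurableSet {z : X × Y | H z.1 z.2 ≤ N z.2} :=
        measurableSet_le hH (hN.comp measurable_snd)
      rw [Measure.ae_ae_comm hmeas]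
      exact .of_forall fun y => ae_le_eLpNorm_top fun x => H x y
    filter_upwards [hswap] with x hx using lintegral_mono_ae hx
  · have hr := one_le_toReal hp hp'
    have hNsnd : Measurable (Function.uncurry fun (_ : X) y => N y) := hN.comp measurable_snd
    have hquot : Measurable (Function.uncurry fun x y => (N y)⁻¹ * H x y) := hNsnd.inv.mul hH
    have hmeas : Measurable (Function.uncurry fun x y => N y * ((N y)⁻¹ * H x y) ^ p.toReal) :=
      hNsnd.mul (hquot.pow_const _)
    rw [← ENNReal.rpow_le_rpow_iff (one_pos.trans_le hr), eLpNorm_rpow_toReal hp hp']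
    calc ∫⁻ x, (∫⁻ y, H x y ∂ν) ^ p.toReal ∂μ
        ≤ ∫⁻ x, (∫⁻ y, N y * ((N y)⁻¹ * H x y) ∂ν) ^ p.toReal ∂μ := by
          refine lintegral_mono_ae ?_
          filter_upwards [ae_le_eLpNorm_mul_inv_mul hH hp hfin] with x hx
          gcongr ?_ ^ _
          exact lintegral_mono_ae hx
      _ ≤ (∫⁻ y, N y ∂ν) ^ (p.toReal - 1) *
          ∫⁻ x, ∫⁻ y, N y * ((N y)⁻¹ * H x y) ^ p.toReal ∂ν ∂μ :=
          lintegral_rpow_lintegral_mul_le hNsnd hquot (fun _ => le_rfl) hr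
      _ ≤ (∫⁻ y, N y ∂ν) ^ (p.toReal - 1) * ∫⁻ y, N y ∂ν := by
          rw [lintegral_lintegral_swap hmeas.aemeasurable]
          gcongr with y
          rw [lintegral_const_mul _ (hquot.of_uncurry_right.pow_const _)]
          exact mul_le_of_le_one_right'
            (lintegral_inv_eLpNorm_mul_rpow_le hH.of_uncurry_right hp hp')
      _ = _ := rpow_sub_one_mul_self hr

end Inequalities

section Convolution

variable {G : Type*} [MeasurableSpace G] {μ : Measure G}

theorem eLpNorm_ennreal_const_mul {F : G → ℝ≥0∞} (hF : Measurable F) (c : ℝ≥0∞) {p : ℝ≥0∞}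
    (hp : 1 ≤ p) : eLpNorm (fun x => c * F x) p μ = c * eLpNorm F p μ := by
  rcases eq_or_ne p ∞ with rfl | hp'
  · simp only [eLpNorm_exponent_top, eLpNormEssSup, enorm_eq_self, ENNReal.essSup_const_mul]
  · have hr : 0 < p.toReal := one_pos.trans_le (one_le_toReal hp hp')
    refine ENNReal.rpow_left_injective hr.ne' ?_
    simp only
    rw [ENNReal.mul_rpow_of_nonneg _ _ hr.le, eLpNorm_rpow_toReal hp hp',
      eLpNorm_rpow_toReal hp hp', ← lintegral_const_mul _ (hF.pow_const _)]
    simp_rw [ENNReal.mul_rpow_of_nonneg _ _ hr.le]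

variable [AddGroup G] [MeasurableAdd₂ G] [SFinite μ] [μ.IsAddRightInvariant]

theorem eLpNorm_lintegral_mul_translate_le {ν : Measure G} [SFinite ν] {w F : G → ℝ≥0∞}
    (hw : Measurable w) (hF : Measurable F) {p : ℝ≥0∞} (hp : 1 ≤ p) :
    eLpNorm (fun t => ∫⁻ z, w z * F (t + z) ∂ν) p μ ≤ (∫⁻ z, w z ∂ν) * eLpNorm F p μ := by
  have hmeas : Measurable (Function.uncurry fun t z => w z * F (t + z)) :=
    (hw.comp measurable_snd).mul (hF.comp measurable_add)
  refine (eLpNorm_lintegral_le hmeas hp).trans_eq ?_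
  rw [← lintegral_mul_const _ hw]
  refine lintegral_congr fun z => ?_
  have hFz : Measurable fun t => F (t + z) := hF.comp (measurable_add_const z)
  rw [eLpNorm_ennreal_const_mul hFz _ hp]
  exact congrArg _ (eLpNorm_comp_measurePreserving hF.aestronglyMeasurable
    (measurePreserving_add_right μ z))

theorem eLpNorm_lintegral_mul_convolution_le {Y : Type*} [MeasurableSpace Y] {ν : Measure Y}
    [SFinite ν] {κ : Y → ℝ≥0∞} (hκ : Measurable κ) {w : G → ℝ≥0∞} (hw : Measurable w)
    {F : Y → G → ℝ≥0∞} (hF : Measurable (Function.uncurry F)) {p : ℝ≥0∞} (hp : 1 ≤ p) :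
    eLpNorm (fun t => ∫⁻ y, κ y * ∫⁻ z, w z * F y (t + z) ∂μ ∂ν) p μ ≤
      (∫⁻ z, w z ∂μ) * ∫⁻ y, κ y * eLpNorm (F y) p μ ∂ν := by
  have htranslate : Measurable fun v : (G × Y) × G => F v.1.2 (v.1.1 + v.2) :=
    hF.comp (by fun_prop : Measurable fun v : (G × Y) × G => (v.1.2, v.1.1 + v.2))
  have hconv : Measurable (Function.uncurry fun t y => ∫⁻ z, w z * F y (t + z) ∂μ) :=
    Measurable.lintegral_prod_right' ((hw.comp measurable_snd).mul htranslate)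
  calc eLpNorm (fun t => ∫⁻ y, κ y * ∫⁻ z, w z * F y (t + z) ∂μ ∂ν) p μ
      ≤ ∫⁻ y, eLpNorm (fun t => κ y * ∫⁻ z, w z * F y (t + z) ∂μ) p μ ∂ν :=
        eLpNorm_lintegral_le ((hκ.comp measurable_snd).mul hconv) hp
    _ ≤ ∫⁻ y, (∫⁻ z, w z ∂μ) * (κ y * eLpNorm (F y) p μ) ∂ν := by
        refine lintegral_mono fun y => ?_
        rw [eLpNorm_ennreal_const_mul hconv.of_uncurry_right _ hp, mul_left_comm]
        gcongr
        exact eLpNorm_lintegral_mul_translate_le hw hF.of_uncurry_left hp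
    _ = _ := by
        refine lintegral_const_mul _ (hκ.mul ?_)
        exact measurable_eLpNorm_left (H := fun t y => F y t) (hF.comp measurable_swap) hp

end Convolution

/-! ### Translation bounded measures -/

section TranslationBounded

variable {E : Type*} [NormedAddCommGroup E]

/-- The weight `(1 + ‖v‖) ^ (-N)`, with values in `[0, ∞]`; integrals of its translates control
the kernels that compare two families of coefficients. -/
def decay (N : ℕ) (v : E) : ℝ≥0∞ := ENNReal.ofReal ((1 + ‖v‖) ^ N)⁻¹

theorem continuous_decay (N : ℕ) : Continuous (decay N : E → ℝ≥0∞) := by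
  refine ENNReal.continuous_ofReal.comp (Continuous.inv₀ (by fun_prop) fun v => ?_)
  positivity

theorem decay_add (M N : ℕ) (v : E) : decay (M + N) v = decay M v * decay N v := by
  rw [decay, decay, decay, pow_add, mul_inv, ENNReal.ofReal_mul (by positivity)]

theorem decay_sub_comm (N : ℕ) (v w : E) : decay N (v - w) = decay N (w - v) := by
  rw [decay, decay, norm_sub_rev]

theorem ofReal_one_add_norm_pow_mul_decay (N : ℕ) (v : E) :
    ENNReal.ofReal ((1 + ‖v‖) ^ N) * decay N v = 1 := by
  rw [decay, ← ENNReal.ofReal_mul (by positivity), mul_inv_cancel₀ (by positivity),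
    ENNReal.ofReal_one]

theorem decay_le_mul_decay (N : ℕ) {x y : E} {r : ℝ} (h : ‖x - y‖ ≤ r) :
    decay N x ≤ ENNReal.ofReal ((1 + r) ^ N) * decay N y := by
  have hr : 0 ≤ r := (norm_nonneg _).trans h
  rw [decay, decay, ← ENNReal.ofReal_mul (by positivity)]
  refine ENNReal.ofReal_le_ofReal ?_
  rw [← div_eq_mul_inv, le_div_iff₀ (by positivity), inv_mul_le_iff₀ (by positivity), ← mul_pow,
    mul_comm]
  gcongr
  calc 1 + ‖y‖ ≤ (1 + ‖y - x‖) * (1 + ‖y - (y - x)‖) := one_add_norm_le_mul y (y - x)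
    _ ≤ (1 + r) * (1 + ‖x‖) := by
      rw [norm_sub_rev, sub_sub_cancel]
      gcongr

variable [MeasurableSpace E]

theorem lintegral_decay_ne_top [BorelSpace E] [NormedSpace ℝ E] [FiniteDimensional ℝ E]
    {μ : Measure E} [μ.IsAddHaarMeasure] {N : ℕ} (hN : Module.finrank ℝ E < N) :
    ∫⁻ v, decay N v ∂μ ≠ ∞ := by
  have h := (integrable_one_add_norm (E := E) (μ := μ) (r := N) (mod_cast hN)).lintegral_lt_top
  refine (lintegral_congr fun v => ?_).trans_ne h.ne
  rw [decay, Real.rpow_neg (by positivity), Real.rpow_natCast]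

theorem lintegral_setLIntegral_ball_swap [OpensMeasurableSpace E] [SecondCountableTopology E]
    {μ ν : Measure E} [SFinite μ] [SFinite ν] {g : E → ℝ≥0∞} (hg : Measurable g) (r : ℝ) :
    ∫⁻ ξ, ∫⁻ η in Metric.ball ξ r, g η ∂ν ∂μ = ∫⁻ η, g η * μ (Metric.ball η r) ∂ν := by
  have hset : MeasurableSet {w : E × E | dist w.2 w.1 < r} :=
    measurableSet_lt (measurable_snd.dist measurable_fst) measurable_const
  have hmeas : Measurable (Function.uncurry fun ξ η => (Metric.ball ξ r).indicator g η) :=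
    (hg.comp measurable_snd).indicator hset
  simp_rw [← lintegral_indicator measurableSet_ball]
  rw [lintegral_lintegral_swap hmeas.aemeasurable]
  refine lintegral_congr fun η => ?_
  rw [← lintegral_indicator_const measurableSet_ball]
  refine lintegral_congr fun ξ => ?_
  simp only [Set.indicator, Metric.mem_ball, dist_comm]

/-- Measures whose mass on the balls of some fixed radius is bounded, uniformly in the centre. -/
def IsTranslationBounded (μ : Measure E) : Prop :=
  ∃ r > 0, ∃ A : ℝ≥0, ∀ z, μ (Metric.ball z r) ≤ A

namespace IsTranslationBounded

variable {μ : Measure E}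

theorem isLocallyFiniteMeasure (hμ : IsTranslationBounded μ) : IsLocallyFiniteMeasure μ := by
  obtain ⟨r, hr, A, hA⟩ := hμ
  exact ⟨fun z => ⟨_, Metric.ball_mem_nhds z hr, (hA z).trans_lt ENNReal.coe_lt_top⟩⟩

theorem sigmaFinite [SecondCountableTopology E] (hμ : IsTranslationBounded μ) :
    SigmaFinite μ := by
  have := hμ.isLocallyFiniteMeasure
  infer_instance

variable [BorelSpace E] [NormedSpace ℝ E] [FiniteDimensional ℝ E]

theorem exists_lintegral_decay_le (hμ : IsTranslationBounded μ) {N : ℕ}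
    (hN : Module.finrank ℝ E < N) : ∃ C : ℝ≥0, ∀ z, ∫⁻ ξ, decay N (z - ξ) ∂μ ≤ C := by
  have := hμ.sigmaFinite
  obtain ⟨r, hr, A, hA⟩ := hμ
  set lam : Measure E := Measure.addHaar
  set v := lam (Metric.ball 0 r)
  set c := ENNReal.ofReal ((1 + r) ^ N)
  have hv : v ≠ 0 := (Metric.measure_ball_pos _ _ hr).ne'
  have hv' : v ≠ ∞ := measure_ball_lt_top.ne
  have hbound : c * (∫⁻ η : E, decay N η ∂lam) * A / v ≠ ∞ := by
    have := lintegral_decay_ne_top (μ := lam) hN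
    finiteness
  have hdecay (z : E) : Measurable fun η => decay N (z - η) :=
    ((continuous_decay N).comp (continuous_const.sub continuous_id)).measurable
  refine ⟨(c * (∫⁻ η : E, decay N η ∂lam) * A / v).toNNReal, fun z => ?_⟩
  rw [ENNReal.coe_toNNReal hbound, ENNReal.le_div_iff_mul_le (.inl hv) (.inl hv')]
  -- averaging over the balls of radius `r` replaces `μ` by Haar measure
  calc (∫⁻ ξ, decay N (z - ξ) ∂μ) * v
      = ∫⁻ ξ, ∫⁻ _ in Metric.ball ξ r, decay N (z - ξ) ∂lam ∂μ := by
        simp_rw [setLIntegral_const, Measure.addHaar_ball_center lam]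
        exact (lintegral_mul_const _ (hdecay z)).symm
    _ ≤ ∫⁻ ξ, ∫⁻ η in Metric.ball ξ r, c * decay N (z - η) ∂lam ∂μ := by
        refine lintegral_mono fun ξ =>
          setLIntegral_mono ((hdecay z).const_mul c) fun η hη => decay_le_mul_decay N ?_
        rw [sub_sub_sub_cancel_left, ← dist_eq_norm]
        exact (Metric.mem_ball.1 hη).le
    _ = ∫⁻ η, c * decay N (z - η) * μ (Metric.ball η r) ∂lam :=
        lintegral_setLIntegral_ball_swap ((hdecay z).const_mul c) r
    _ ≤ ∫⁻ η, c * decay N (z - η) * A ∂lam := by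
        gcongr with η
        exact hA η
    _ = c * (∫⁻ η : E, decay N η ∂lam) * A := by
        rw [lintegral_mul_const _ ((hdecay z).const_mul c), lintegral_const_mul _ (hdecay z),
          lintegral_sub_left_eq_self (fun η : E => decay N η) z]

theorem integrable_one_add_norm_pow_inv (hμ : IsTranslationBounded μ) {N : ℕ}
    (hN : Module.finrank ℝ E < N) : Integrable (fun ξ => ((1 + ‖ξ‖) ^ N)⁻¹) μ := by
  obtain ⟨C, hC⟩ := hμ.exists_lintegral_decay_le hN
  have hcont : Continuous fun ξ : E => ((1 + ‖ξ‖) ^ N)⁻¹ :=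
    Continuous.inv₀ (by fun_prop) fun ξ => by positivity
  refine ⟨hcont.aestronglyMeasurable, ?_⟩
  rw [hasFiniteIntegral_iff_ofReal (.of_forall fun ξ => by positivity)]
  refine lt_of_le_of_lt ?_ (ENNReal.coe_lt_top (r := C))
  simpa only [decay, zero_sub, norm_neg] using hC 0

end IsTranslationBounded

theorem isTranslationBounded_of_isAddHaarMeasure [BorelSpace E] [NormedSpace ℝ E]
    [FiniteDimensional ℝ E] (μ : Measure E) [μ.IsAddHaarMeasure] : IsTranslationBounded μ := by
  refine ⟨1, one_pos, (μ (Metric.ball 0 1)).toNNReal, fun z => ?_⟩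
  rw [ENNReal.coe_toNNReal measure_ball_lt_top.ne, Measure.addHaar_ball_center]

end TranslationBounded

section Lattice

variable {n : ℕ}

local notation "𝔼" => EuclideanSpace ℝ (Fin n)

theorem one_le_norm_latticePoint_sub {k l : Fin n → ℤ} (h : k ≠ l) :
    1 ≤ ‖latticePoint k - latticePoint l‖ := by
  obtain ⟨i, hi⟩ := Function.ne_iff.1 h
  refine le_trans ?_ (PiLp.norm_apply_le (latticePoint k - latticePoint l) i)
  have hcoord : (latticePoint k - latticePoint l) i = ((k i - l i : ℤ) : ℝ) := by
    simp [latticePoint]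
  rw [hcoord, Real.norm_eq_abs, ← Int.cast_abs]
  exact_mod_cast Int.one_le_abs (sub_ne_zero.2 hi)

/-- The sum of the unit masses at the points of `ℤⁿ`; sums over `ℤⁿ` are integrals with respect
to it. -/
def latticeMeasure (n : ℕ) : Measure (EuclideanSpace ℝ (Fin n)) :=
  Measure.count.map latticePoint

theorem measurableEmbedding_latticePoint : MeasurableEmbedding (latticePoint (n := n)) := by
  have hinj : Function.Injective (latticePoint (n := n)) := fun k l h => by
    by_contra hkl
    have hone := one_le_norm_latticePoint_sub hkl
    rw [h, sub_self, norm_zero] at hone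
    linarith
  exact ⟨hinj, .of_discrete, fun _ _ => ((Set.to_countable _).image _).measurableSet⟩

theorem isTranslationBounded_latticeMeasure : IsTranslationBounded (latticeMeasure n) := by
  refine ⟨1 / 2, by norm_num, 1, fun z => ?_⟩
  rw [latticeMeasure, measurableEmbedding_latticePoint.map_apply, Measure.count_apply
    (Set.to_countable _).measurableSet, ENNReal.coe_one]
  have hsub : (latticePoint ⁻¹' Metric.ball z (1 / 2)).Subsingleton := fun k hk l hl => by
    by_contra hkl
    have hone := one_le_norm_latticePoint_sub hkl
    rw [← dist_eq_norm] at hone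
    linarith [dist_triangle_right (latticePoint k) (latticePoint l) z, Metric.mem_ball.1 hk,
      Metric.mem_ball.1 hl]
  exact_mod_cast Set.encard_le_one_iff_subsingleton.2 hsub

end Lattice

/-! ### Peetre's inequality -/

section Bracket

theorem one_add_norm_sq_le {E : Type*} [NormedAddCommGroup E] (ξ η : E) :
    1 + ‖ξ‖ ^ 2 ≤ 2 * (1 + ‖ξ - η‖) ^ 2 * (1 + ‖η‖ ^ 2) := by
  have hξ : ‖ξ‖ ≤ ‖η‖ + ‖ξ - η‖ := norm_le_norm_add_norm_sub' ξ η
  have := norm_nonneg η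
  have hsub := norm_nonneg (ξ - η)
  have hsq : ‖ξ‖ ^ 2 ≤ (‖η‖ + ‖ξ - η‖) ^ 2 := by gcongr
  nlinarith [sq_nonneg (‖η‖ - ‖ξ - η‖), mul_nonneg hsub (sq_nonneg ‖η‖),
    mul_nonneg (sq_nonneg ‖ξ - η‖) (sq_nonneg ‖η‖)]

variable {n : ℕ}

local notation "𝔼" => EuclideanSpace ℝ (Fin n)

theorem bracket_pos (s : ℝ) (ξ : 𝔼) : 0 < bracket s ξ := by
  unfold bracket
  positivity

theorem continuous_bracket (s : ℝ) : Continuous (bracket (n := n) s) := by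
  unfold bracket
  exact Continuous.rpow_const (by fun_prop) fun ξ => .inl (by positivity)

theorem bracket_neg (s : ℝ) (ξ : 𝔼) : bracket (-s) ξ = (bracket s ξ)⁻¹ := by
  rw [bracket, bracket, ← Real.rpow_neg (by positivity), neg_div]

theorem bracket_le_of_nonneg {s : ℝ} (hs : 0 ≤ s) (ξ η : 𝔼) :
    bracket s ξ ≤ 2 ^ (s / 2) * (1 + ‖ξ - η‖) ^ (2 * ⌈s / 2⌉₊) * bracket s η := by
  have hone : (1 : ℝ) ≤ (1 + ‖ξ - η‖) ^ 2 := one_le_pow₀ (by linarith [norm_nonneg (ξ - η)])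
  calc (1 + ‖ξ‖ ^ 2) ^ (s / 2)
      ≤ (2 * (1 + ‖ξ - η‖) ^ 2 * (1 + ‖η‖ ^ 2)) ^ (s / 2) := by
        gcongr
        exact one_add_norm_sq_le ξ η
    _ = 2 ^ (s / 2) * ((1 + ‖ξ - η‖) ^ 2) ^ (s / 2) * (1 + ‖η‖ ^ 2) ^ (s / 2) := by
        rw [Real.mul_rpow (by positivity) (by positivity),
          Real.mul_rpow (by positivity) (by positivity)]
    _ ≤ _ := by
        rw [pow_mul, ← Real.rpow_natCast _ ⌈s / 2⌉₊, bracket]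
        gcongr
        exact Nat.le_ceil _

theorem exists_bracket_le (s : ℝ) : ∃ (C : ℝ) (M : ℕ), ∀ ξ η : 𝔼,
    bracket s ξ ≤ C * (1 + ‖ξ - η‖) ^ M * bracket s η := by
  rcases le_total 0 s with hs | hs
  · exact ⟨_, _, bracket_le_of_nonneg hs⟩
  · refine ⟨2 ^ (-s / 2), 2 * ⌈-s / 2⌉₊, fun ξ η => ?_⟩
    have h := bracket_le_of_nonneg (neg_nonneg.2 hs) η ξ
    rwa [bracket_neg, bracket_neg, norm_sub_rev, ← div_eq_mul_inv, le_div_iff₀ (bracket_pos s ξ),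
      inv_mul_le_iff₀ (bracket_pos s η), mul_comm (bracket s η)] at h

theorem exists_ofReal_bracket_mul_decay_le (s : ℝ) : ∃ (C : ℝ≥0) (M : ℕ), ∀ ξ η : 𝔼,
    ENNReal.ofReal (bracket s ξ) * decay M (ξ - η) ≤ C * ENNReal.ofReal (bracket s η) := by
  obtain ⟨C, M, hC⟩ := exists_bracket_le (n := n) s
  refine ⟨C.toNNReal, M, fun ξ η => ?_⟩
  calc ENNReal.ofReal (bracket s ξ) * decay M (ξ - η)
      ≤ ENNReal.ofReal (C * (1 + ‖ξ - η‖) ^ M * bracket s η) * decay M (ξ - η) := by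
        gcongr
        exact hC ξ η
    _ = ENNReal.ofReal C * ENNReal.ofReal (bracket s η) *
          (ENNReal.ofReal ((1 + ‖ξ - η‖) ^ M) * decay M (ξ - η)) := by
        rw [ENNReal.ofReal_mul' (bracket_pos s η).le, ENNReal.ofReal_mul' (by positivity)]
        ring
    _ = _ := by rw [ofReal_one_add_norm_pow_mul_decay, mul_one, ENNReal.ofReal]

end Bracket

/-! ### Comparison of the coefficients for two windows -/

section Comparison

variable {n : ℕ}

local notation "𝔼" => EuclideanSpace ℝ (Fin n)

/-- The coefficient `U(e ^ {i t·} d(· - ξ))` of the tempered distribution `U` at frequency `ξ` and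
position `t`, for the frequency window `d`. -/
def coeff (U : 𝓢(𝔼, ℂ) →L[ℂ] ℂ) (d : 𝓢(𝔼, ℂ)) (ξ t : 𝔼) : ℂ := U (modulate t (translate ξ d))

/-- The mixed norm of the coefficients of `U` for the window `d`: the weighted `L^q(μ)` norm in the
frequency of the `L^p` norm in the position. -/
def mixedNorm (μ : Measure 𝔼) (s : ℝ) (p q : ℝ≥0∞) (d : 𝓢(𝔼, ℂ)) (U : 𝓢(𝔼, ℂ) →L[ℂ] ℂ) : ℝ≥0∞ :=
  eLpNorm (fun ξ => ENNReal.ofReal (bracket s ξ) * eLpNorm (coeff U d ξ) p volume) q μ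

/-- The translates of `b * d`, integrated against `μ`, resolve the identity. -/
def IsDualWindow (μ : Measure 𝔼) (b d : 𝓢(𝔼, ℂ)) : Prop :=
  ∀ η, ∫ ξ, b (η - ξ) * d (η - ξ) ∂μ = 1

theorem continuous_coeff (U : 𝓢(𝔼, ℂ) →L[ℂ] ℂ) (d : 𝓢(𝔼, ℂ)) :
    Continuous (Function.uncurry (coeff U d)) :=
  U.continuous.comp (continuous_modulate.comp (f := fun z : 𝔼 × 𝔼 => (z.2, translate z.1 d))
    (continuous_snd.prodMk ((continuous_translate_left d).comp continuous_fst)))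

theorem IsDualWindow.apply_eq_integral {μ : Measure 𝔼} {b d : 𝓢(𝔼, ℂ)}
    (hbd : IsDualWindow μ b d) (hμ : IsTranslationBounded μ) (U : 𝓢(𝔼, ℂ) →L[ℂ] ℂ)
    (m : 𝓢(𝔼, ℂ)) : U m = ∫ ξ, U (mulS (translate ξ (mulS b d)) m) ∂μ := by
  have hcont : Continuous fun ξ => mulS (translate ξ (mulS b d)) m := by
    simp_rw [mulS_comm _ m]
    exact (SchwartzMap.smulLeftCLM ℂ m).continuous.comp (continuous_translate_left _)
  refine ModulationSpace.apply_eq_integral U hcont (fun k l => ?_) fun η => ?_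
  · have hp := (schwartz_withSeminorms ℂ 𝔼 ℂ).continuous_seminorm (k, l)
    obtain ⟨C, hC⟩ := exists_mulS_translate_le hp (mulS b d) m (n + 1)
    have hint : Integrable (fun ξ : 𝔼 => ((1 + ‖ξ‖) ^ (n + 1))⁻¹) μ :=
      hμ.integrable_one_add_norm_pow_inv (by simp)
    refine (hint.const_mul C).mono' (hp.comp hcont).aestronglyMeasurable (.of_forall fun ξ => ?_)
    rw [Real.norm_of_nonneg (apply_nonneg _ _), ← div_eq_mul_inv, le_div_iff₀' (by positivity)]
    exact hC ξ
  · simp_rw [mulS_apply, translate_apply, mulS_apply]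
    rw [integral_mul_const, hbd, one_mul]

theorem exists_enorm_fourierS_mulS_le (a b : 𝓢(𝔼, ℂ)) (M N : ℕ) : ∃ C : ℝ≥0, ∀ x y z : 𝔼,
    ‖fourierS n (mulS (translate x a) (translate y b)) z‖ₑ ≤
      C * decay M (x - y) * decay N z := by
  obtain ⟨C, hC⟩ := exists_mulS_translate_le
    (p := (supSeminorm N 0).comp (fourierS n).toLinearMap)
    ((continuous_supSeminorm N 0).comp (fourierS n).continuous) a b M
  refine ⟨(2 ^ N * C).toNNReal, fun x y z => ?_⟩
  set v := fourierS n (mulS (translate (x - y) a) b)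
  have hv : (1 + ‖x - y‖) ^ M * ((1 + ‖z‖) ^ N * ‖v z‖) ≤ 2 ^ N * C :=
    calc (1 + ‖x - y‖) ^ M * ((1 + ‖z‖) ^ N * ‖v z‖)
        ≤ (1 + ‖x - y‖) ^ M * (2 ^ N * supSeminorm N 0 v) := by
          refine mul_le_mul_of_nonneg_left ?_ (by positivity)
          simpa only [norm_iteratedFDeriv_zero] using le_supSeminorm N (le_refl 0) v z
      _ = 2 ^ N * ((1 + ‖x - y‖) ^ M * supSeminorm N 0 v) := mul_left_comm _ _ _
      _ ≤ 2 ^ N * C := by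
          gcongr
          exact hC (x - y)
  rw [mulS_translate_translate, fourierS_translate, ← ofReal_norm, norm_modulate_apply,
    ← ENNReal.ofReal, decay, decay, ← ENNReal.ofReal_mul' (by positivity),
    ← ENNReal.ofReal_mul' (by positivity)]
  refine ENNReal.ofReal_le_ofReal ?_
  rwa [← div_eq_mul_inv, ← div_eq_mul_inv, le_div_iff₀' (by positivity),
    le_div_iff₀' (by positivity)]

variable {μ : Measure (EuclideanSpace ℝ (Fin n))} {b d : 𝓢(EuclideanSpace ℝ (Fin n), ℂ)}

theorem IsDualWindow.enorm_coeff_le (hbd : IsDualWindow μ b d) (hμ : IsTranslationBounded μ)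
    (U : 𝓢(𝔼, ℂ) →L[ℂ] ℂ) (a : 𝓢(𝔼, ℂ)) (ξ t : 𝔼) :
    ‖coeff U a ξ t‖ₑ ≤ ∫⁻ η, ‖normFactor n‖ₑ * (∫⁻ z,
      ‖fourierS n (mulS (translate ξ a) (translate η b)) z‖ₑ * ‖coeff U d η (t + z)‖ₑ) ∂μ := by
  rw [coeff, hbd.apply_eq_integral hμ]
  refine (enorm_integral_le_lintegral_enorm _).trans ?_
  refine lintegral_mono fun η => ?_
  have hswap : mulS (translate η (mulS b d)) (modulate t (translate ξ a)) =
      modulate t (mulS (mulS (translate ξ a) (translate η b)) (translate η d)) := by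
    ext ζ
    simp only [mulS_apply, translate_apply, modulate_apply]
    ring
  rw [hswap]
  exact enorm_apply_modulate_mulS_le U _ _ t

theorem IsDualWindow.exists_enorm_coeff_le (hbd : IsDualWindow μ b d)
    (hμ : IsTranslationBounded μ) (a : 𝓢(𝔼, ℂ)) (M N : ℕ) :
    ∃ C : ℝ≥0, ∀ (U : 𝓢(𝔼, ℂ) →L[ℂ] ℂ) (ξ t : 𝔼),
      ‖coeff U a ξ t‖ₑ ≤
        ∫⁻ η, C * decay M (ξ - η) * (∫⁻ z, decay N z * ‖coeff U d η (t + z)‖ₑ) ∂μ := by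
  obtain ⟨C, hC⟩ := exists_enorm_fourierS_mulS_le a b M N
  refine ⟨‖normFactor n‖₊ * C, fun U ξ t => (hbd.enorm_coeff_le hμ U a ξ t).trans ?_⟩
  refine lintegral_mono fun η => ?_
  have hmeas : Measurable fun z => decay N z * ‖coeff U d η (t + z)‖ₑ :=
    (continuous_decay N).measurable.mul
      ((continuous_coeff U d).comp (f := fun z => (η, t + z)) (by fun_prop)).measurable.enorm
  rw [ENNReal.coe_mul, mul_assoc, mul_assoc, ← mul_assoc (C : ℝ≥0∞), ← lintegral_const_mul _ hmeas]
  simp_rw [← mul_assoc]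
  gcongr with z
  · exact le_rfl
  · exact hC ξ η z

theorem IsDualWindow.exists_eLpNorm_coeff_le (hbd : IsDualWindow μ b d)
    (hμ : IsTranslationBounded μ) (a : 𝓢(𝔼, ℂ)) (M : ℕ) :
    ∃ C : ℝ≥0, ∀ (U : 𝓢(𝔼, ℂ) →L[ℂ] ℂ) (p : ℝ≥0∞), 1 ≤ p → ∀ ξ : 𝔼,
      eLpNorm (coeff U a ξ) p volume ≤
        C * ∫⁻ η, decay M (ξ - η) * eLpNorm (coeff U d η) p volume ∂μ := by
  have := hμ.sigmaFinite
  obtain ⟨C, hC⟩ := hbd.exists_enorm_coeff_le hμ a M (n + 1)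
  have hW : ∫⁻ z : 𝔼, decay (n + 1) z ≠ ∞ := lintegral_decay_ne_top (by simp)
  refine ⟨(∫⁻ z : 𝔼, decay (n + 1) z).toNNReal * C, fun U p hp ξ => ?_⟩
  have hκ : Measurable fun η => C * decay M (ξ - η) :=
    ((continuous_decay M).comp (continuous_const.sub continuous_id)).measurable.const_mul _
  calc eLpNorm (coeff U a ξ) p volume
      ≤ eLpNorm (fun t => ∫⁻ η, C * decay M (ξ - η) *
          (∫⁻ z, decay (n + 1) z * ‖coeff U d η (t + z)‖ₑ) ∂μ) p volume :=
        eLpNorm_mono_enorm (hC U ξ)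
    _ ≤ (∫⁻ z : 𝔼, decay (n + 1) z) * ∫⁻ η, C * decay M (ξ - η) *
          eLpNorm (fun t => ‖coeff U d η t‖ₑ) p volume ∂μ :=
        eLpNorm_lintegral_mul_convolution_le (F := fun η t => ‖coeff U d η t‖ₑ) hκ
          (continuous_decay _).measurable (continuous_coeff U d).measurable.enorm hp
    _ = _ := by
        simp_rw [eLpNorm_enorm, mul_assoc (C : ℝ≥0∞)]
        rw [lintegral_const_mul' _ _ ENNReal.coe_ne_top, ENNReal.coe_mul, ENNReal.coe_toNNReal hW,
          mul_assoc]

theorem measurable_eLpNorm_coeff (U : 𝓢(𝔼, ℂ) →L[ℂ] ℂ) (d : 𝓢(𝔼, ℂ)) {p : ℝ≥0∞} (hp : 1 ≤ p) :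
    Measurable fun ξ => eLpNorm (coeff U d ξ) p volume := by
  simpa only [eLpNorm_enorm] using measurable_eLpNorm_left (μ := volume) (p := p)
    (H := fun t ξ => ‖coeff U d ξ t‖ₑ)
    ((continuous_coeff U d).comp continuous_swap).measurable.enorm hp

theorem IsDualWindow.exists_bracket_mul_eLpNorm_coeff_le (hbd : IsDualWindow μ b d)
    (hμ : IsTranslationBounded μ) (a : 𝓢(𝔼, ℂ)) (s : ℝ) (N : ℕ) :
    ∃ C : ℝ≥0, ∀ (U : 𝓢(𝔼, ℂ) →L[ℂ] ℂ) (p : ℝ≥0∞), 1 ≤ p → ∀ ξ : 𝔼,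
      ENNReal.ofReal (bracket s ξ) * eLpNorm (coeff U a ξ) p volume ≤
        ∫⁻ η, C * decay N (ξ - η) *
          (ENNReal.ofReal (bracket s η) * eLpNorm (coeff U d η) p volume) ∂μ := by
  obtain ⟨B, M, hB⟩ := exists_ofReal_bracket_mul_decay_le (n := n) s
  obtain ⟨C, hC⟩ := hbd.exists_eLpNorm_coeff_le hμ a (M + N)
  refine ⟨C * B, fun U p hp ξ => ?_⟩
  calc ENNReal.ofReal (bracket s ξ) * eLpNorm (coeff U a ξ) p volume
      ≤ ENNReal.ofReal (bracket s ξ) *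
          (C * ∫⁻ η, decay (M + N) (ξ - η) * eLpNorm (coeff U d η) p volume ∂μ) := by
        gcongr
        exact hC U p hp ξ
    _ = ∫⁻ η, C * ((ENNReal.ofReal (bracket s ξ) * decay M (ξ - η)) *
          (decay N (ξ - η) * eLpNorm (coeff U d η) p volume)) ∂μ := by
        rw [← lintegral_const_mul' _ _ ENNReal.coe_ne_top,
          ← lintegral_const_mul' _ _ ENNReal.ofReal_ne_top]
        simp_rw [decay_add]
        exact lintegral_congr fun η => by ring
    _ ≤ ∫⁻ η, C * ((B * ENNReal.ofReal (bracket s η)) *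
          (decay N (ξ - η) * eLpNorm (coeff U d η) p volume)) ∂μ := by
        gcongr ∫⁻ η, C * (?_ * _) ∂μ with η
        exact hB ξ η
    _ = _ := by
        rw [ENNReal.coe_mul]
        exact lintegral_congr fun η => by ring

theorem IsDualWindow.exists_mixedNorm_le (hbd : IsDualWindow μ b d) (hμ : IsTranslationBounded μ)
    {ν : Measure 𝔼} (hν : IsTranslationBounded ν) (a : 𝓢(𝔼, ℂ)) (s : ℝ) :
    ∃ C : ℝ≥0, ∀ (U : 𝓢(𝔼, ℂ) →L[ℂ] ℂ) (p q : ℝ≥0∞), 1 ≤ p → 1 ≤ q →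
      mixedNorm ν s p q a U ≤ C * mixedNorm μ s p q d U := by
  have := hμ.sigmaFinite
  have := hν.sigmaFinite
  obtain ⟨C, hC⟩ := hbd.exists_bracket_mul_eLpNorm_coeff_le hμ a s (n + 1)
  obtain ⟨A, hA⟩ := hμ.exists_lintegral_decay_le (N := n + 1) (by simp)
  obtain ⟨A', hA'⟩ := hν.exists_lintegral_decay_le (N := n + 1) (by simp)
  refine ⟨C * (A + A'), fun U p q hp hq => ?_⟩
  have hweight : Measurable fun η => ENNReal.ofReal (bracket s η) *
      eLpNorm (coeff U d η) p volume :=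
    (continuous_bracket s).measurable.ennreal_ofReal.mul (measurable_eLpNorm_coeff U d hp)
  have hkernel : Measurable (Function.uncurry fun ξ η : 𝔼 => C * decay (n + 1) (ξ - η)) :=
    ((continuous_decay (n + 1)).comp (continuous_fst.sub continuous_snd)).measurable.const_mul _
  rw [ENNReal.coe_mul, ENNReal.coe_add]
  refine (eLpNorm_mono_enorm fun ξ => ?_).trans
    (eLpNorm_lintegral_mul_le hkernel hweight (fun ξ => ?_) (fun η => ?_) hq)
  · simpa only [enorm_eq_self] using hC U p hp ξ
  · rw [lintegral_const_mul' _ _ ENNReal.coe_ne_top]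
    gcongr
    exact (hA ξ).trans le_self_add
  · rw [lintegral_const_mul' _ _ ENNReal.coe_ne_top]
    gcongr
    simp_rw [decay_sub_comm _ _ η]
    exact (hA' η).trans le_add_self

end Comparison

/-! ### The two modulation norms as mixed norms -/

section Norms

variable {n : ℕ}

local notation "𝔼" => EuclideanSpace ℝ (Fin n)

theorem stftNorm_eq (φ : 𝓢(𝔼, ℂ)) (s : ℝ) {p q : ℝ≥0∞} (hp : 1 ≤ p) (hq : 1 ≤ q)
    (f : 𝓢'(𝔼, ℂ)) :
    stftNorm φ s p q f =
      ‖normFactor n‖ₑ * mixedNorm volume s p q (conjS (fourierS n φ)) (fourierD n f) := by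
  have hmeas : Measurable fun ξ : 𝔼 => ENNReal.ofReal (bracket s ξ) *
      eLpNorm (coeff (fourierD n f) (conjS (fourierS n φ)) ξ) p volume :=
    (continuous_bracket s).measurable.ennreal_ofReal.mul (measurable_eLpNorm_coeff _ _ hp)
  unfold stftNorm mixedNorm
  rw [← eLpNorm_ennreal_const_mul hmeas _ hq]
  congr 1
  ext ξ
  have hb : ENNReal.ofReal (bracket s ξ) = ‖((bracket s ξ : ℝ) : ℂ)‖ₑ := by
    rw [← ofReal_norm, Complex.norm_real, Real.norm_of_nonneg (bracket_pos s ξ).le]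
  rw [hb, ← mul_assoc, ← enorm_mul, ← eLpNorm_const_smul]
  refine eLpNorm_congr_enorm_ae (.of_forall fun x => ?_)
  rw [enorm_mul, enorm_stft, Pi.smul_apply, enorm_smul, enorm_mul]
  exact mul_right_comm _ _ _

theorem Represents.ae_eq {g h : 𝔼 → ℂ} {T : 𝓢'(𝔼, ℂ)} (hg : Represents g T)
    (hh : Represents h T) (hgi : LocallyIntegrable g) (hhi : LocallyIntegrable h) :
    g =ᵐ[volume] h := by
  refine ae_eq_of_integral_contDiff_smul_eq hgi hhi fun u hu hc => ?_
  let v : 𝓢(𝔼, ℂ) := (hc.comp_left (g := ((↑) : ℝ → ℂ)) Complex.ofReal_zero).toSchwartzMap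
    (Complex.ofRealCLM.contDiff.comp hu)
  have hv : ∀ x, v x = (u x : ℂ) := fun x => rfl
  have hpairing := (hg v).symm.trans (hh v)
  simp_rw [hv, mul_comm _ ((u _ : ℝ) : ℂ), ← Complex.real_smul] at hpairing
  exact hpairing

theorem Represents.lpNorm_eq {g : 𝔼 → ℂ} {T : 𝓢'(𝔼, ℂ)} (hg : Represents g T)
    (hcont : Continuous g) {p : ℝ≥0∞} (hp : 1 ≤ p) : lpNorm p T = eLpNorm g p volume := by
  refine le_antisymm ?_ ?_
  · rcases eq_or_ne (eLpNorm g p volume) ∞ with htop | hfin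
    · exact htop ▸ le_top
    · exact iInf₂_le_of_le g ⟨hcont.aestronglyMeasurable, hfin.lt_top⟩ (iInf_le _ hg)
  · refine le_iInf fun h => le_iInf fun hmem => le_iInf fun hh => ?_
    exact (eLpNorm_congr_ae
      (hg.ae_eq hh hcont.locallyIntegrable (hmem.locallyIntegrable hp))).le

theorem exists_isDualWindow_volume {d : 𝓢(𝔼, ℂ)} (hd : d ≠ 0) :
    ∃ b, IsDualWindow volume b d := by
  set A : ℝ := ∫ ξ : 𝔼, ‖d ξ‖ ^ 2
  have hA : A ≠ 0 := fun h => by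
    have hint : Integrable fun ξ : 𝔼 => ‖d ξ‖ ^ 2 :=
      (memLp_two_iff_integrable_sq_norm d.continuous.aestronglyMeasurable).1 (d.memLp 2)
    have hzero := (Continuous.ae_eq_iff_eq volume (d.continuous.norm.pow 2) continuous_const).1
      ((integral_eq_zero_iff_of_nonneg (fun ξ => by positivity) hint).1 h)
    exact hd (SchwartzMap.ext fun ξ => norm_eq_zero.1 (pow_eq_zero_iff two_ne_zero |>.1
      (congr_fun hzero ξ)))
  refine ⟨(A : ℂ)⁻¹ • conjS d, fun η => ?_⟩
  rw [integral_sub_left_eq_self (fun ξ => ((A : ℂ)⁻¹ • conjS d) ξ * d ξ) volume η]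
  have hsq : ∀ ξ, ((A : ℂ)⁻¹ • conjS d) ξ * d ξ = (A : ℂ)⁻¹ * ((‖d ξ‖ ^ 2 : ℝ) : ℂ) := fun ξ => by
    rw [smul_apply, smul_eq_mul, conjS_apply, mul_assoc, Complex.conj_mul', Complex.ofReal_pow]
  simp_rw [hsq]
  rw [integral_const_mul, integral_complex_ofReal, inv_mul_cancel₀ (Complex.ofReal_ne_zero.2 hA)]

end Norms

/-! ### The frequency-uniform decomposition -/

section Decomposition

variable {n : ℕ}

local notation "𝔼" => EuclideanSpace ℝ (Fin n)

theorem latticePoint_zero : latticePoint (0 : Fin n → ℤ) = 0 := by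
  ext i
  simp [latticePoint]

theorem latticePoint_add (k l : Fin n → ℤ) :
    latticePoint (k + l) = latticePoint k + latticePoint l := by
  ext i
  simp [latticePoint]

theorem sigma_zero_eq (ρ : 𝓢(𝔼, ℝ)) (ξ : 𝔼) :
    sigma ρ 0 ξ = ρ ξ * (∑' l : Fin n → ℤ, ρ (ξ - latticePoint l))⁻¹ := by
  rw [sigma, latticePoint_zero, sub_zero]

theorem sigma_zero_sub_latticePoint (ρ : 𝓢(𝔼, ℝ)) (k : Fin n → ℤ) (ξ : 𝔼) :
    sigma ρ 0 (ξ - latticePoint k) = sigma ρ k ξ := by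
  rw [sigma_zero_eq, sigma, ← (Equiv.addLeft k).tsum_eq fun l => ρ (ξ - latticePoint l)]
  simp only [Equiv.coe_addLeft, latticePoint_add, sub_sub]

/-- A Schwartz function that equals `1` on the cube `[-1, 1]ⁿ`, where `σ₀` is supported. -/
def cutoff (n : ℕ) : 𝓢(EuclideanSpace ℝ (Fin n), ℂ) :=
  let χ : ContDiffBump (0 : EuclideanSpace ℝ (Fin n)) :=
    ⟨√n + 1, √n + 2, by positivity, by linarith⟩
  (χ.hasCompactSupport.comp_left (g := ((↑) : ℝ → ℂ)) Complex.ofReal_zero).toSchwartzMap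
    (Complex.ofRealCLM.contDiff.comp χ.contDiff)

theorem norm_le_sqrt_of_forall_abs_le {ξ : 𝔼} (h : ∀ i, |ξ i| ≤ 1) : ‖ξ‖ ≤ √n := by
  rw [EuclideanSpace.norm_eq]
  refine Real.sqrt_le_sqrt ?_
  calc ∑ i, ‖ξ i‖ ^ 2 ≤ ∑ _i : Fin n, (1 : ℝ) := Finset.sum_le_sum fun i _ =>
        pow_le_one₀ (norm_nonneg _) (h i)
    _ = n := by simp

theorem cutoff_eq_one {ξ : 𝔼} (h : ∀ i, |ξ i| ≤ 1) : cutoff n ξ = 1 := by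
  let χ : ContDiffBump (0 : 𝔼) := ⟨√n + 1, √n + 2, by positivity, by linarith⟩
  have hχ : χ ξ = 1 := χ.one_of_mem_closedBall (mem_closedBall_zero_iff.2
    ((norm_le_sqrt_of_forall_abs_le h).trans (le_add_of_nonneg_right zero_le_one)))
  change ((χ ξ : ℝ) : ℂ) = 1
  rw [hχ, Complex.ofReal_one]

/-- The function `σ₀` as a Schwartz function. Multiplying by `cutoff n` does not change it. -/
def sigmaS (ρ : 𝓢(𝔼, ℝ)) : 𝓢(𝔼, ℂ) :=
  SchwartzMap.smulLeftCLM ℂ (fun ξ => (sigma ρ 0 ξ : ℂ)) (cutoff n)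

variable {ρ : 𝓢(EuclideanSpace ℝ (Fin n), ℝ)}

namespace IsDecompositionFunction

theorem hasSum_sigma (hρ : IsDecompositionFunction ρ) (ξ : 𝔼) :
    HasSum (fun k : Fin n → ℤ => sigma ρ k ξ) 1 := by
  have hfin : (Function.support fun k : Fin n → ℤ => ρ (ξ - latticePoint k)).Finite := by
    refine (Set.Finite.pi' (fun i : Fin n => Set.finite_Icc ⌈ξ i - 1⌉ ⌊ξ i + 1⌋)).subset
      fun k hk i => ?_
    have h := hρ.support_subset _ hk i
    simp only [latticePoint, PiLp.sub_apply] at h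
    exact ⟨Int.ceil_le.2 (by linarith), Int.le_floor.2 (by linarith)⟩
  have hsum : Summable fun l : Fin n → ℤ => ρ (ξ - latticePoint l) :=
    summable_of_hasFiniteSupport hfin
  obtain ⟨m, hm⟩ := hρ.cover ξ
  have hpos := hsum.tsum_pos (fun l => hρ.nonneg _) m ((hρ.nonneg _).lt_of_ne' hm)
  have h := hsum.hasSum.mul_right (∑' l : Fin n → ℤ, ρ (ξ - latticePoint l))⁻¹
  rwa [mul_inv_cancel₀ hpos.ne'] at h

theorem sigma_zero_mul_cutoff (hρ : IsDecompositionFunction ρ) (ξ : 𝔼) :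
    (sigma ρ 0 ξ : ℂ) * cutoff n ξ = sigma ρ 0 ξ := by
  by_cases h : ρ ξ = 0
  · simp [sigma_zero_eq, h]
  · rw [cutoff_eq_one fun i => abs_le.2 (hρ.support_subset ξ h i), mul_one]

theorem sigmaS_apply (hρ : IsDecompositionFunction ρ) (ξ : 𝔼) : sigmaS ρ ξ = sigma ρ 0 ξ := by
  rw [sigmaS, SchwartzMap.smulLeftCLM_apply_apply (sigma_hasTemperateGrowth hρ 0), smul_eq_mul,
    hρ.sigma_zero_mul_cutoff]

theorem isDualWindow_cutoff (hρ : IsDecompositionFunction ρ) :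
    IsDualWindow (latticeMeasure n) (cutoff n) (sigmaS ρ) := fun η => by
  have hterm : ∀ k : Fin n → ℤ, cutoff n (η - latticePoint k) * sigmaS ρ (η - latticePoint k) =
      (sigma ρ k η : ℂ) := fun k => by
    rw [hρ.sigmaS_apply, mul_comm, hρ.sigma_zero_mul_cutoff, sigma_zero_sub_latticePoint]
  have hsum : HasSum (fun k : Fin n → ℤ => (sigma ρ k η : ℂ)) 1 := by
    simpa using Complex.ofRealCLM.hasSum (hρ.hasSum_sigma η)
  rw [latticeMeasure, measurableEmbedding_latticePoint.integral_map]
  simp_rw [hterm]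
  rw [integral_countable (integrable_count_iff.2 hsum.summable.norm)]
  simpa using hsum.tsum_eq

theorem represents_box (hρ : IsDecompositionFunction ρ) (k : Fin n → ℤ) (f : 𝓢'(𝔼, ℂ)) :
    Represents (fun x => normFactor n * coeff (fourierD n f) (sigmaS ρ) (latticePoint k) x)
      (box ρ k f) := fun u => by
  have hsigma : SchwartzMap.smulLeftCLM ℂ (fun ξ => (sigma ρ k ξ : ℂ)) (fourierInvS n u) =
      mulS (translate (latticePoint k) (sigmaS ρ)) (fourierInvS n u) := by
    ext ξ
    rw [SchwartzMap.smulLeftCLM_apply_apply (sigma_hasTemperateGrowth hρ k), mulS_apply,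
      translate_apply, hρ.sigmaS_apply, sigma_zero_sub_latticePoint, smul_eq_mul]
  calc box ρ k f u = fourierD n f (mulS (translate (latticePoint k) (sigmaS ρ))
        (fourierInvS n u)) := congrArg (fourierD n f) hsigma
    _ = normFactor n * ∫ x, u x * coeff (fourierD n f) (sigmaS ρ) (latticePoint k) x :=
        apply_mulS_fourierInvS _ _ u
    _ = _ := by
        rw [← integral_const_mul]
        congr 1
        ext x
        ring

theorem lpNorm_box (hρ : IsDecompositionFunction ρ) (k : Fin n → ℤ) (f : 𝓢'(𝔼, ℂ)) {p : ℝ≥0∞}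
    (hp : 1 ≤ p) : lpNorm p (box ρ k f) = ‖normFactor n‖ₑ *
      eLpNorm (coeff (fourierD n f) (sigmaS ρ) (latticePoint k)) p volume := by
  have hcont : Continuous (coeff (fourierD n f) (sigmaS ρ) (latticePoint k)) :=
    (continuous_coeff _ _).comp (f := fun t => (latticePoint k, t)) (by fun_prop)
  rw [(hρ.represents_box k f).lpNorm_eq (continuous_const.mul hcont) hp, ← eLpNorm_const_smul]
  rfl

theorem decompositionNorm_eq (hρ : IsDecompositionFunction ρ) (s : ℝ) {p q : ℝ≥0∞} (hp : 1 ≤ p)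
    (hq : 1 ≤ q) (f : 𝓢'(𝔼, ℂ)) :
    decompositionNorm ρ s p q f =
      ‖normFactor n‖ₑ * mixedNorm (latticeMeasure n) s p q (sigmaS ρ) (fourierD n f) := by
  unfold mixedNorm
  rw [latticeMeasure, measurableEmbedding_latticePoint.eLpNorm_map_measure,
    Function.comp_def, ← eLpNorm_ennreal_const_mul .of_discrete _ hq]
  simp_rw [mul_left_comm ‖normFactor n‖ₑ, ← hρ.lpNorm_box _ f hp]
  rw [decompositionNorm]
  split_ifs with h
  · rw [h, eLpNorm_exponent_top, eLpNormEssSup_count]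
    simp only [enorm_eq_self]
  · rw [eLpNorm_eq_lintegral_rpow_enorm_toReal (zero_lt_one.trans_le hq).ne' h, lintegral_count]
    simp only [enorm_eq_self]

end IsDecompositionFunction

theorem conjS_fourierS_ne_zero {φ : 𝓢(𝔼, ℂ)} (hφ : φ ≠ 0) : conjS (fourierS n φ) ≠ 0 := by
  intro h
  have hφ' : fourierS n φ = 0 := SchwartzMap.ext fun ξ => star_eq_zero.1 (DFunLike.congr_fun h ξ)
  exact hφ (by rw [← fourierInvS_fourierS φ, hφ', map_zero])

theorem exists_stftNorm_le (hρ : IsDecompositionFunction ρ) (φ : 𝓢(𝔼, ℂ)) (s : ℝ) :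
    ∃ C : ℝ≥0, ∀ p q : ℝ≥0∞, 1 ≤ p → 1 ≤ q → ∀ f : 𝓢'(𝔼, ℂ),
      stftNorm φ s p q f ≤ C * decompositionNorm ρ s p q f := by
  obtain ⟨C, hC⟩ := hρ.isDualWindow_cutoff.exists_mixedNorm_le isTranslationBounded_latticeMeasure
    (isTranslationBounded_of_isAddHaarMeasure volume) (conjS (fourierS n φ)) s
  refine ⟨C, fun p q hp hq f => ?_⟩
  rw [stftNorm_eq φ s hp hq, hρ.decompositionNorm_eq s hp hq, mul_left_comm]
  gcongr
  exact hC _ p q hp hq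

theorem exists_decompositionNorm_le (hρ : IsDecompositionFunction ρ) {φ : 𝓢(𝔼, ℂ)} (hφ : φ ≠ 0)
    (s : ℝ) :
    ∃ C : ℝ≥0, ∀ p q : ℝ≥0∞, 1 ≤ p → 1 ≤ q → ∀ f : 𝓢'(𝔼, ℂ),
      decompositionNorm ρ s p q f ≤ C * stftNorm φ s p q f := by
  obtain ⟨b, hb⟩ := exists_isDualWindow_volume (conjS_fourierS_ne_zero hφ)
  obtain ⟨C, hC⟩ := hb.exists_mixedNorm_le (isTranslationBounded_of_isAddHaarMeasure volume)
    isTranslationBounded_latticeMeasure (sigmaS ρ) s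
  refine ⟨C, fun p q hp hq f => ?_⟩
  rw [stftNorm_eq φ s hp hq, hρ.decompositionNorm_eq s hp hq, mul_left_comm]
  gcongr
  exact hC _ p q hp hq

end Decomposition

end ModulationSpace

end

theorem proposition1p12 (n : ℕ)
    (φ : 𝓢(EuclideanSpace ℝ (Fin n), ℂ)) (hφ : φ ≠ 0)
    (ρ : 𝓢(EuclideanSpace ℝ (Fin n), ℝ)) (hρ : ModulationSpace.IsDecompositionFunction ρ)
    (s : ℝ) :
    ∃ C₁ C₂ : ℝ≥0, 0 < C₁ ∧ 0 < C₂ ∧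
      ∀ p q : ℝ≥0∞, 1 ≤ p → 1 ≤ q →
        ∀ f : 𝓢'(EuclideanSpace ℝ (Fin n), ℂ),
          C₁ * ModulationSpace.stftNorm φ s p q f ≤ ModulationSpace.decompositionNorm ρ s p q f ∧
          ModulationSpace.decompositionNorm ρ s p q f ≤ C₂ * ModulationSpace.stftNorm φ s p q f := by
  obtain ⟨C, hC⟩ := ModulationSpace.exists_stftNorm_le hρ φ s
  obtain ⟨C', hC'⟩ := ModulationSpace.exists_decompositionNorm_le hρ hφ s
  refine ⟨(C + 1)⁻¹, C' + 1, by positivity, by positivity, fun p q hp hq f => ⟨?_, ?_⟩⟩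
  · rw [ENNReal.coe_inv (by positivity), ENNReal.inv_mul_le_iff (by simp) (by simp)]
    refine (hC p q hp hq f).trans ?_
    gcongr
    exact le_self_add
  · refine (hC' p q hp hq f).trans ?_
    gcongr
    exact le_self_add
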